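/- Consider a stochastic $K$-armed Gaussian bandit, $K\ge 1$: the $i$-th pull of arm $k$ gives the reward $Y_{k,i}\sim N(\mu_k,1)$, all rewards being independent. Arm $1$ is optimal, $\mu_1=\max_k\mu_k$, and the gaps $\Delta_k=\mu_1-\mu_k$ satisfy $\Delta_k<1$ for all $k$. The algorithm ReBoot with exploration aid unit $\sigma_a>0$ and Gaussian bootstrap weights pulls arm $t$ in round $t$ for $t=1,\dots,K$. In every round $t>K$ it computes, for every arm $k$ with observed rewards $Y_{k,1},\dots,Y_{k,s}$ ($s$ being the number of pulls of arm $k$ so far), the index $$\hat\mu_k^*=\bar Y_{k,s}+\frac1{s+2}\sum_{i=1}^{s+2}w_i e_{k,i},\qquad \bar Y_{k,s}=\frac1s\sum_{i=1}^s Y_{k,i},$$ where $e_{k,i}=Y_{k,i}-\bar Y_{k,s}$ for $i\le s$, $e_{k,s+1}=\sqrt{s+2}\,\sigma_a$, $e_{k,s+2}=-\sqrt{s+2}\,\sigma_a$, and the weights $w_i$ are i.i.d. $N(0,1)$, drawn afresh for every round and every arm and independent of the rewards; it then pulls an arm $I_t\in\arg\max_k\hat\mu_k^*$ (ties being broken by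 any fixed measurable rule). Let $r_t$ be the reward received in round $t$. Take $\sigma_a=1.7$. Then there is an absolute constant $C>0$ (not depending on $K$, on the means, on $T$ or on the rule for ties) such that for every horizon $T\ge1$ the total reward $\sum_{t=1}^T r_t$ is integrable and the expected regret $R(T)=T\mu_1-E\big[\sum_{t=1}^T r_t\big]$ satisfies $$R(T)\le C\Big(\sum_{k:\,\Delta_k>0}\Delta_k+\sum_{k:\,\Delta_k>0}\frac{\log T}{\Delta_k}\Big).$$ -/

import Mathlib

open MeasureTheory ProbabilityTheory

noncomputable section

namespace ReBoot

/-- Average of the first `s` entries of the reward sequence `y`. -/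
def avgReward (y : ℕ → ℝ) (s : ℕ) : ℝ :=
  (∑ i ∈ Finset.range s, y i) / s

/-- The augmented residuals of an arm with history `y 0, …, y (s - 1)`: the `s` residuals
`y i - avgReward y s`, followed (at positions `s` and `s + 1`) by the two pseudo residuals
`√(s + 2) * σa` and `-√(s + 2) * σa`. -/
def augResidual (σa : ℝ) (y : ℕ → ℝ) (s i : ℕ) : ℝ :=
  if i < s then y i - avgReward y s
  else if i = s then √((s : ℝ) + 2) * σa
  else -(√((s : ℝ) + 2) * σa)

/-- The arm index: the average reward of the history `y 0, …, y (s - 1)` plus the average of the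
`s + 2` augmented residuals multiplied by the bootstrap weights `w 0, …, w (s + 1)`. -/
def armIndex (σa : ℝ) (y : ℕ → ℝ) (s : ℕ) (w : ℕ → ℝ) : ℝ :=
  avgReward y s + (∑ i ∈ Finset.range (s + 2), w i * augResidual σa y s i) / ((s : ℝ) + 2)

/-- `sel` is an arg max rule: it returns a coordinate at which its argument is maximal (so it
also fixes how ties are broken). -/
def IsArgmaxRule {K : ℕ} (sel : (Fin K → ℝ) → Fin K) : Prop :=
  ∀ (x : Fin K → ℝ) (k : Fin K), x k ≤ x (sel x)

/-- The arm pulled in round `t` (rounds are numbered from `0`) when arm `k` has been pulled `n k`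
times before: arm `t` in the first `K` rounds, afterwards the arm with the largest index.
`Y k i` is the reward of the pull number `i` of arm `k` (so the history of arm `k` consists of
`Y k 0, …, Y k (n k - 1)`), and `w t k` are the fresh bootstrap weights of arm `k` in round `t`. -/
def chooseArm {K : ℕ} (σa : ℝ) (sel : (Fin K → ℝ) → Fin K) (Y : Fin K → ℕ → ℝ)
    (w : ℕ → Fin K → ℕ → ℝ) (t : ℕ) (n : Fin K → ℕ) : Fin K :=
  if h : t < K then ⟨t, h⟩
  else sel (fun k => armIndex σa (Y k) (n k) (w t k))

/-- `pulls σa sel Y w t k` is the number of pulls of arm `k` in the rounds before round `t`. -/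
def pulls {K : ℕ} (σa : ℝ) (sel : (Fin K → ℝ) → Fin K) (Y : Fin K → ℕ → ℝ)
    (w : ℕ → Fin K → ℕ → ℝ) : ℕ → Fin K → ℕ
  | 0 => fun _ => 0
  | t + 1 => fun k =>
      pulls σa sel Y w t k +
        if chooseArm σa sel Y w t (pulls σa sel Y w t) = k then 1 else 0

/-- The arm pulled in round `t` by the algorithm. -/
def arm {K : ℕ} (σa : ℝ) (sel : (Fin K → ℝ) → Fin K) (Y : Fin K → ℕ → ℝ)
    (w : ℕ → Fin K → ℕ → ℝ) (t : ℕ) : Fin K :=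
  chooseArm σa sel Y w t (pulls σa sel Y w t)

/-- The reward received in round `t` by the algorithm. -/
def reward {K : ℕ} (σa : ℝ) (sel : (Fin K → ℝ) → Fin K) (Y : Fin K → ℕ → ℝ)
    (w : ℕ → Fin K → ℕ → ℝ) (t : ℕ) : ℝ :=
  Y (arm σa sel Y w t) (pulls σa sel Y w t (arm σa sel Y w t))

/-- The cumulative reward of the first `T` rounds. -/
def totalReward {K : ℕ} (σa : ℝ) (sel : (Fin K → ℝ) → Fin K) (Y : Fin K → ℕ → ℝ)
    (w : ℕ → Fin K → ℕ → ℝ) (T : ℕ) : ℝ :=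
  ∑ t ∈ Finset.range T, reward σa sel Y w t

/-- The sub-optimality gap of arm `k`; the first arm (number `0`) is the optimal one. -/
def gap {K : ℕ} [NeZero K] (μ : Fin K → ℝ) (k : Fin K) : ℝ := μ 0 - μ k

/-- The randomness of the Gaussian bandit with mean vector `μ` and unit variances, played with
standard Gaussian bootstrap weights: the reward `Y k i` of the pull number `i` of arm `k` has law
`N(μ k, 1)`, the weight `w t k i` of round `t`, arm `k` and position `i` has law `N(0, 1)`, and
all these random variables are independent. -/
structure IsGaussianBandit {K : ℕ} {Ω : Type*} [MeasurableSpace Ω] (P : Measure Ω)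
    (μ : Fin K → ℝ) (Y : Fin K → ℕ → Ω → ℝ) (w : ℕ → Fin K → ℕ → Ω → ℝ) : Prop where
  measurable_reward : ∀ k i, Measurable (Y k i)
  measurable_weight : ∀ t k i, Measurable (w t k i)
  law_reward : ∀ k i, P.map (Y k i) = gaussianReal (μ k) 1
  law_weight : ∀ t k i, P.map (w t k i) = gaussianReal 0 1
  indep : iIndepFun
    (Sum.elim (fun p : Fin K × ℕ => Y p.1 p.2)
      (fun q : ℕ × Fin K × ℕ => w q.1 q.2.1 q.2.2)) P

/-- The expected cumulative regret `T * μ 0 - E[∑ rewards]` of the first `T` rounds. -/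
def regret {K : ℕ} [NeZero K] {Ω : Type*} [MeasurableSpace Ω] (P : Measure Ω) (μ : Fin K → ℝ)
    (σa : ℝ) (sel : (Fin K → ℝ) → Fin K) (Y : Fin K → ℕ → Ω → ℝ)
    (w : ℕ → Fin K → ℕ → Ω → ℝ) (T : ℕ) : ℝ :=
  T * μ 0 - ∫ ω, totalReward σa sel (fun k i => Y k i ω) (fun t k i => w t k i ω) T ∂P

end ReBoot

end

noncomputable section

namespace ReBoot
open scoped ENNReal NNReal

/-! The regret is the sum over arms of gap times expected number of pulls (`regret_eq`), so it
suffices to show that an arm `k` of gap `D > 0` is pulled `O((1 + log T) / D²)` times on average.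
Given the history, an index is Gaussian with mean the average reward and variance `idxVar`; it
depends only on the fresh weights, so every one-round estimate is made with all other randomness
frozen.

Suppose arm `k` is pulled. Either it has fewer than `L ≈ 448 log T / D²` pulls, or its history is
atypical, or its history is typical and its index still exceeds `μ k + D / 2`, or all indices are at
most `μ k + D / 2 = μ a - D / 2`, where `a` is the optimal arm. The first two cases are summed over
pulls of `k`; the third has probability at most `1 / T` in each round.

The last case is the heart of the matter: arm `a` may have been unlucky and stay underestimated. If
the other indices are below `μ a - D / 2`, arm `a` is pulled as soon as its own index is above.
Hence the probability that all indices are low is at most the odds (low against high) of the index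
of `a`, integrated over the event that `a` is pulled (`measure_forall_roundIndex_le`). Every such
round uses up one pull of `a`, so the sum over rounds is at most the sum over `s` of the expected
odds after `s` pulls, whatever the adaptive order of play (`sum_lintegral_ite_arm_le`).

It remains to see that the expected odds decay exponentially in `s`. For an average reward below its
mean by `x`, the odds are of order `exp (c s x²)`, while `s x²` is the square of a standard normal
variable; the expectation is finite only for `c < 1 / 2`. The exploration aid makes the index
variance large enough for `c = 0.39` (`gaussianReal_odds_le`), which leaves room for the decay in
`s` (`lintegral_atypical_le`). -/

/-! ### Gaussian tails, exponential moments and linear combinations -/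

lemma gaussianReal_Ioi_le (m : ℝ) {v : ℝ≥0} (hv : v ≠ 0) {τ : ℝ} (h : m ≤ τ) :
    gaussianReal m v (Set.Ioi τ) ≤ ENNReal.ofReal (Real.exp (-(τ - m) ^ 2 / (2 * v))) := by
  have hv' : (0 : ℝ) < v := by positivity
  have ht : 0 ≤ (τ - m) / v := div_nonneg (sub_nonneg.2 h) hv'.le
  have h1 := measure_ge_le_exp_mul_mgf (μ := gaussianReal m v) (X := id) τ ht
    (integrable_exp_mul_gaussianReal _)
  rw [mgf_id_gaussianReal, ← Real.exp_add] at h1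
  refine (measure_mono (t := {x | τ ≤ id x}) (fun x hx => (Set.mem_Ioi.1 hx).le)).trans ?_
  rw [← ENNReal.ofReal_toReal (measure_ne_top _ _)]
  refine ENNReal.ofReal_le_ofReal (h1.trans (le_of_eq ?_))
  congr 1
  field_simp
  ring

lemma gaussianReal_Iic_le (m : ℝ) {v : ℝ≥0} (hv : v ≠ 0) {τ : ℝ} (h : τ ≤ m) :
    gaussianReal m v (Set.Iic τ) ≤ ENNReal.ofReal (Real.exp (-(τ - m) ^ 2 / (2 * v))) := by
  have hv' : (0 : ℝ) < v := by positivity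
  have ht : (τ - m) / v ≤ 0 := div_nonpos_of_nonpos_of_nonneg (sub_nonpos.2 h) hv'.le
  have h1 := measure_le_le_exp_mul_mgf (μ := gaussianReal m v) (X := id) τ ht
    (integrable_exp_mul_gaussianReal _)
  rw [mgf_id_gaussianReal, ← Real.exp_add] at h1
  refine (measure_mono (t := {x | id x ≤ τ}) (fun x hx => hx)).trans ?_
  rw [← ENNReal.ofReal_toReal (measure_ne_top _ _)]
  refine ENNReal.ofReal_le_ofReal (h1.trans (le_of_eq ?_))
  congr 1
  field_simp
  ring

lemma gaussianReal_eq_map_standard (m : ℝ) (v : ℝ≥0) :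
    gaussianReal m v = (gaussianReal 0 1).map (fun x => √v * x + m) := by
  have : (fun x : ℝ => √v * x + m) = (fun x => x + m) ∘ (fun x => √v * x) := rfl
  rw [this, ← Measure.map_map (by fun_prop) (by fun_prop), gaussianReal_map_const_mul,
    gaussianReal_map_add_const]
  congr 1
  · simp
  · ext; simp

/-- On the unit interval to the right of `z ≥ 0` the density is smallest at the right end. -/
lemma standardGaussian_Ioi_ge {z : ℝ} (hz : 0 ≤ z) :
    ENNReal.ofReal (gaussianPDFReal 0 1 (z + 1)) ≤ gaussianReal 0 1 (Set.Ioi z) := by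
  calc ENNReal.ofReal (gaussianPDFReal 0 1 (z + 1))
      = ∫⁻ _ in Set.Ioc z (z + 1), ENNReal.ofReal (gaussianPDFReal 0 1 (z + 1)) := by simp
    _ ≤ ∫⁻ x in Set.Ioc z (z + 1), gaussianPDF 0 1 x := by
        refine setLIntegral_mono (measurable_gaussianPDF 0 1) fun x hx => ?_
        refine ENNReal.ofReal_le_ofReal ?_
        simp only [gaussianPDFReal, sub_zero]
        have hx0 : 0 ≤ x := hz.trans hx.1.le
        have := hx.2
        gcongr
    _ = gaussianReal 0 1 (Set.Ioc z (z + 1)) := (gaussianReal_apply 0 one_ne_zero _).symm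
    _ ≤ _ := measure_mono Set.Ioc_subset_Ioi_self

/-- The constant in the lower bound for Gaussian tails. -/
def tailConst : ℝ := (√(2 * Real.pi))⁻¹ * Real.exp (-(3 / 2))

lemma tailConst_pos : 0 < tailConst := by unfold tailConst; positivity

/-- The coefficient `3 / 4` in place of the sharp `1 / 2` buys a bound without a polynomial factor;
the variance bound `idxVar_ge` can afford this loss. -/
lemma gaussianReal_Ioi_ge {m : ℝ} {v : ℝ≥0} (hv : v ≠ 0) {τ z : ℝ} (hz : 0 ≤ z)
    (h : τ ≤ m + √v * z) :
    ENNReal.ofReal (tailConst * Real.exp (-(3 / 4 * z ^ 2))) ≤ gaussianReal m v (Set.Ioi τ) := by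
  have hs : 0 < √(v : ℝ) := Real.sqrt_pos.2 (by positivity)
  rw [gaussianReal_eq_map_standard m v, Measure.map_apply (by fun_prop) measurableSet_Ioi]
  refine le_trans ?_ ((standardGaussian_Ioi_ge hz).trans (measure_mono fun x hx => ?_))
  · refine ENNReal.ofReal_le_ofReal ?_
    simp only [gaussianPDFReal, tailConst, mul_assoc, ← Real.exp_add, NNReal.coe_one, mul_one]
    gcongr
    -- Uses `(z + 1)² / 2 = 3 / 4 * z² + 3 / 2 - (z - 2)² / 4`.
    nlinarith [sq_nonneg (z - 2)]
  · simp only [Set.mem_preimage, Set.mem_Ioi] at hx ⊢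
    nlinarith

lemma lintegral_exp_sq_gaussianReal {θ : ℝ} (hθ : θ < 1 / 2) :
    ∫⁻ x, ENNReal.ofReal (Real.exp (θ * x ^ 2)) ∂(gaussianReal 0 1)
      = ENNReal.ofReal (√(1 - 2 * θ))⁻¹ := by
  have hb : 0 < 1 / 2 - θ := by linarith
  rw [gaussianReal_of_var_ne_zero 0 one_ne_zero,
    lintegral_withDensity_eq_lintegral_mul _ (measurable_gaussianPDF 0 1) (by fun_prop)]
  have : ∀ x : ℝ, (gaussianPDF 0 1 * fun x => ENNReal.ofReal (Real.exp (θ * x ^ 2))) x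
      = ENNReal.ofReal ((√(2 * Real.pi))⁻¹ * Real.exp (-(1 / 2 - θ) * x ^ 2)) := by
    intro x
    simp only [Pi.mul_apply, gaussianPDF, gaussianPDFReal]
    rw [← ENNReal.ofReal_mul (by positivity), mul_assoc, ← Real.exp_add]
    simp only [NNReal.coe_one, mul_one, sub_zero]
    congr 3
    ring
  simp_rw [this]
  rw [← ofReal_integral_eq_lintegral_ofReal ((integrable_exp_neg_mul_sq hb).const_mul _)
    (Filter.Eventually.of_forall fun x => by positivity), integral_const_mul, integral_gaussian]
  congr 1
  rw [← Real.sqrt_inv, ← Real.sqrt_inv, ← Real.sqrt_mul (by positivity)]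
  congr 1
  have := Real.pi_pos
  have : 1 - 2 * θ ≠ 0 := by linarith
  have : (1 : ℝ) / 2 - θ ≠ 0 := hb.ne'
  field_simp

lemma map_sum_mul_gaussianReal {Ω : Type*} [MeasurableSpace Ω] {P : Measure Ω}
    [IsProbabilityMeasure P] {X : ℕ → Ω → ℝ} {m : ℝ} (hX : ∀ i, Measurable (X i))
    (hlaw : ∀ i, P.map (X i) = gaussianReal m 1) (hind : iIndepFun X P) (a : ℕ → ℝ) (n : ℕ) :
    P.map (fun ω => ∑ i ∈ Finset.range n, X i ω * a i)
      = gaussianReal (∑ i ∈ Finset.range n, m * a i)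
        (Real.toNNReal (∑ i ∈ Finset.range n, a i ^ 2)) := by
  induction n with
  | zero => simp [Measure.map_const]
  | succ n ih =>
    have hc : iIndepFun (fun i ω => X i ω * a i) P :=
      hind.comp (fun i x => x * a i) (fun i => by fun_prop)
    have h1 := hc.indepFun_finsetSum_of_notMem (fun i => (hX i).mul_const _)
      (s := Finset.range n) (i := n) (by simp)
    have h2 : P.map (fun ω => X n ω * a n) = gaussianReal (m * a n) (Real.toNNReal (a n ^ 2)) := by
      have : (fun ω => X n ω * a n) = (fun x => x * a n) ∘ X n := rfl
      rw [this, ← Measure.map_map (by fun_prop) (hX n), hlaw, gaussianReal_map_mul_const]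
      congr 1
      · ring
      · ext; simp [sq_nonneg]
    have e : (∑ i ∈ Finset.range n, fun ω => X i ω * a i)
        = fun ω => ∑ i ∈ Finset.range n, X i ω * a i := by ext; simp
    rw [e] at h1
    have h3 := gaussianReal_add_gaussianReal_of_indepFun h1 ih h2
    simp_rw [Finset.sum_range_succ]
    rw [Real.toNNReal_add (Finset.sum_nonneg fun i _ => sq_nonneg _) (sq_nonneg _)]
    exact h3

/-! ### What a run of the algorithm depends on -/

section Deterministic
variable {K : ℕ} {σa : ℝ} {sel : (Fin K → ℝ) → Fin K} {Y : Fin K → ℕ → ℝ}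
  {w : ℕ → Fin K → ℕ → ℝ}

lemma pulls_succ (t : ℕ) (k : Fin K) :
    pulls σa sel Y w (t + 1) k
      = pulls σa sel Y w t k + if arm σa sel Y w t = k then 1 else 0 := rfl

lemma arm_of_lt {t : ℕ} (h : t < K) : arm σa sel Y w t = ⟨t, h⟩ := by
  simp [arm, chooseArm, h]

lemma arm_of_le {t : ℕ} (h : K ≤ t) :
    arm σa sel Y w t = sel (fun k => armIndex σa (Y k) (pulls σa sel Y w t k) (w t k)) := by
  simp [arm, chooseArm, h.not_gt]

lemma pulls_mono (k : Fin K) : Monotone (fun t => pulls σa sel Y w t k) :=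
  monotone_nat_of_le_succ fun t => by rw [pulls_succ]; omega

lemma pulls_of_le {t : ℕ} {k : Fin K} (h : t ≤ k) : pulls σa sel Y w t k = 0 := by
  induction t with
  | zero => rfl
  | succ t ih =>
    have hk := k.2
    rw [pulls_succ, ih (by omega), arm_of_lt (by omega)]
    have : (⟨t, by omega⟩ : Fin K) ≠ k := fun e => by
      have := congrArg Fin.val e
      simp only at this
      omega
    simp [this]

lemma pulls_pos {t : ℕ} (ht : K ≤ t) (k : Fin K) : 1 ≤ pulls σa sel Y w t k := by
  have h1 : 1 ≤ pulls σa sel Y w (k + 1) k := by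
    rw [pulls_succ, arm_of_lt k.2]
    simp
  exact h1.trans (pulls_mono k (Nat.succ_le_of_lt (k.2.trans_le ht)))

lemma pulls_eq_sum (T : ℕ) (k : Fin K) :
    pulls σa sel Y w T k = ∑ t ∈ Finset.range T, if arm σa sel Y w t = k then 1 else 0 := by
  induction T with
  | zero => rfl
  | succ T ih => rw [pulls_succ, Finset.sum_range_succ, ih]

/-- Summing over the rounds in which arm `k` is pulled amounts to summing over its pulls. -/
lemma sum_pulls {M : Type*} [AddCommMonoid M] (h : ℕ → M) (T : ℕ) (k : Fin K) :
    ∑ t ∈ Finset.range T, (if arm σa sel Y w t = k then h (pulls σa sel Y w t k) else 0)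
      = ∑ s ∈ Finset.range (pulls σa sel Y w T k), h s := by
  induction T with
  | zero => simp [pulls]
  | succ T ih =>
    rw [Finset.sum_range_succ, ih, pulls_succ]
    split_ifs
    · rw [Finset.sum_range_succ]
    · simp

/-- The counts before round `t` use only earlier weights, so the weights of round `t` may be
overwritten. -/
lemma pulls_congr_weight {w' : ℕ → Fin K → ℕ → ℝ} {t : ℕ} (h : ∀ t' < t, w t' = w' t') :
    pulls σa sel Y w t = pulls σa sel Y w' t := by
  induction t with
  | zero => rfl
  | succ t ih =>
    have ih' := ih fun t' ht' => h t' (by omega)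
    funext k
    have hc : ∀ n, chooseArm σa sel Y w t n = chooseArm σa sel Y w' t n := fun n => by
      unfold chooseArm
      rw [h t (by omega)]
    rw [pulls_succ, pulls_succ, arm, arm, ih', hc]

lemma avgReward_congr {y y' : ℕ → ℝ} {s : ℕ} (h : ∀ i < s, y i = y' i) :
    avgReward y s = avgReward y' s := by
  unfold avgReward
  rw [Finset.sum_congr rfl fun i hi => h i (Finset.mem_range.1 hi)]

lemma armIndex_congr {y y' : ℕ → ℝ} {s : ℕ} (h : ∀ i < s, y i = y' i) (v : ℕ → ℝ) :
    armIndex σa y s v = armIndex σa y' s v := by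
  unfold armIndex
  rw [avgReward_congr h]
  congr 2
  refine Finset.sum_congr rfl fun i _ => ?_
  unfold augResidual
  split_ifs with h1
  · rw [h i h1, avgReward_congr h]
  all_goals rfl

lemma chooseArm_congr_reward {Y' : Fin K → ℕ → ℝ} {t : ℕ} {n : Fin K → ℕ}
    (h : ∀ j, ∀ i < n j, Y j i = Y' j i) : chooseArm σa sel Y w t n = chooseArm σa sel Y' w t n := by
  unfold chooseArm
  split_ifs
  · rfl
  · congr 1
    funext j
    exact armIndex_congr (h j) _

/-- As long as arm `k` has been pulled at most `s` times, its reward number `s` is irrelevant. -/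
lemma pulls_congr_reward {Y' : Fin K → ℕ → ℝ} {k : Fin K} {s : ℕ}
    (h : ∀ j i, (j, i) ≠ (k, s) → Y j i = Y' j i) {t : ℕ} (ht : pulls σa sel Y w t k ≤ s) :
    pulls σa sel Y w t = pulls σa sel Y' w t := by
  induction t with
  | zero => rfl
  | succ t ih =>
    have h0 := (pulls_mono (σa := σa) (sel := sel) (Y := Y) (w := w) k t.le_succ).trans ht
    have ih' := ih h0
    have hc : chooseArm σa sel Y w t (pulls σa sel Y w t)
        = chooseArm σa sel Y' w t (pulls σa sel Y w t) := by
      refine chooseArm_congr_reward fun j i hi => h j i ?_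
      rintro ⟨⟩
      exact absurd hi (by simpa using h0)
    funext j
    rw [pulls_succ, pulls_succ, arm, arm, hc, ih']

lemma arm_congr_reward {Y' : Fin K → ℕ → ℝ} {k : Fin K} {s : ℕ}
    (h : ∀ j i, (j, i) ≠ (k, s) → Y j i = Y' j i) {t : ℕ} (ht : pulls σa sel Y w t k ≤ s) :
    arm σa sel Y w t = arm σa sel Y' w t := by
  rw [arm, arm, ← pulls_congr_reward h ht]
  refine chooseArm_congr_reward fun j i hi => h j i ?_
  rintro ⟨⟩
  exact absurd hi (by simpa using ht)

/-- The decision to make pull `s` of arm `k` looks only at rewards already seen. The bound `pulls ≤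
s` can be read off on either side, which gives both directions. -/
lemma arm_pulls_iff {Y' : Fin K → ℕ → ℝ} {k : Fin K} {s : ℕ}
    (h : ∀ j i, (j, i) ≠ (k, s) → Y j i = Y' j i) (t : ℕ) :
    (arm σa sel Y w t = k ∧ pulls σa sel Y w t k = s)
      ↔ (arm σa sel Y' w t = k ∧ pulls σa sel Y' w t k = s) := by
  constructor
  · rintro ⟨h1, h2⟩
    rw [← arm_congr_reward h h2.le, ← pulls_congr_reward h h2.le]
    exact ⟨h1, h2⟩
  · rintro ⟨h1, h2⟩
    have h' : ∀ j i, (j, i) ≠ (k, s) → Y' j i = Y j i := fun j i hji => (h j i hji).symm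
    rw [← arm_congr_reward h' h2.le, ← pulls_congr_reward h' h2.le]
    exact ⟨h1, h2⟩

end Deterministic

/-! ### Measurability of the run in rewards and weights -/

section Measurability
variable {K : ℕ} {σa : ℝ} {sel : (Fin K → ℝ) → Fin K}

lemma measurable_avgReward (s : ℕ) : Measurable (fun y : ℕ → ℝ => avgReward y s) := by
  unfold avgReward
  fun_prop

lemma measurable_augResidual (s i : ℕ) : Measurable (fun y : ℕ → ℝ => augResidual σa y s i) := by
  unfold augResidual
  have := measurable_avgReward s
  split_ifs <;> fun_prop

lemma measurable_armIndex (s : ℕ) :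
    Measurable (fun p : (ℕ → ℝ) × (ℕ → ℝ) => armIndex σa p.1 s p.2) := by
  unfold armIndex
  have h1 : Measurable (fun p : (ℕ → ℝ) × (ℕ → ℝ) => avgReward p.1 s) :=
    (measurable_avgReward s).comp measurable_fst
  have h2 : ∀ i, Measurable (fun p : (ℕ → ℝ) × (ℕ → ℝ) => augResidual σa p.1 s i) := fun i =>
    (measurable_augResidual s i).comp measurable_fst
  fun_prop

/-- The history length is random but takes countably many values, so measurability for each fixed
length suffices. -/
lemma measurable_armIndex' {α : Type*} [MeasurableSpace α] {y : α → ℕ → ℝ} {n : α → ℕ}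
    {v : α → ℕ → ℝ} (hy : Measurable y) (hn : Measurable n) (hv : Measurable v) :
    Measurable (fun a => armIndex σa (y a) (n a) (v a)) :=
  (measurable_from_prod_countable_left (f := fun p : ((ℕ → ℝ) × (ℕ → ℝ)) × ℕ =>
    armIndex σa p.1.1 p.2 p.1.2) (fun s => measurable_armIndex s)).comp ((hy.prodMk hv).prodMk hn)

lemma measurable_arm_pulls (hsel : Measurable sel) (t : ℕ) :
    Measurable (fun p : (Fin K → ℕ → ℝ) × (ℕ → Fin K → ℕ → ℝ) => arm σa sel p.1 p.2 t) ∧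
    Measurable (fun p : (Fin K → ℕ → ℝ) × (ℕ → Fin K → ℕ → ℝ) => pulls σa sel p.1 p.2 t) := by
  have key : ∀ t, Measurable (fun p : (Fin K → ℕ → ℝ) × (ℕ → Fin K → ℕ → ℝ) =>
        pulls σa sel p.1 p.2 t) →
      Measurable (fun p : (Fin K → ℕ → ℝ) × (ℕ → Fin K → ℕ → ℝ) => arm σa sel p.1 p.2 t) := by
    intro t ht
    by_cases h : t < K
    · simp only [arm_of_lt h]
      exact measurable_const
    · simp only [arm_of_le (not_lt.1 h)]
      refine hsel.comp (measurable_pi_iff.2 fun k => measurable_armIndex' ?_ ?_ ?_)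
      · fun_prop
      · exact (measurable_pi_apply k).comp ht
      · fun_prop
  suffices h : Measurable (fun p : (Fin K → ℕ → ℝ) × (ℕ → Fin K → ℕ → ℝ) =>
      pulls σa sel p.1 p.2 t) from ⟨key t h, h⟩
  induction t with
  | zero => exact measurable_const
  | succ t ih =>
    refine measurable_pi_iff.2 fun k => ?_
    simp only [pulls_succ]
    refine ((measurable_pi_apply k).comp ih).add (Measurable.ite ?_ measurable_const measurable_const)
    exact key t ih (measurableSet_singleton k)

end Measurability

/-! ### The law of an index given the history, and its odds -/

/-- The conditional variance of the arm index given the history. -/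
def idxVar (σa : ℝ) (y : ℕ → ℝ) (s : ℕ) : ℝ :=
  (∑ i ∈ Finset.range (s + 2), augResidual σa y s i ^ 2) / ((s : ℝ) + 2) ^ 2

/-- The sum of the squared deviations from the mean reward. -/
def sqDev (m : ℝ) (y : ℕ → ℝ) (s : ℕ) : ℝ := ∑ i ∈ Finset.range s, (y i - m) ^ 2

/-- A weight that is at least `1` on atypical reward histories. -/
def atypical (m D : ℝ) (y : ℕ → ℝ) (s : ℕ) : ℝ :=
  (if 8 * s < sqDev m y s then 1 else 0)
    + Real.exp (0.44 * (s * (avgReward y s - m) ^ 2) - 0.05 * (s * (D ^ 2 / 16)))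

lemma atypical_nonneg (m D : ℝ) (y : ℕ → ℝ) (s : ℕ) : 0 ≤ atypical m D y s := by
  unfold atypical
  split_ifs <;> positivity

lemma measurable_sqDev (m : ℝ) (s : ℕ) : Measurable (fun y : ℕ → ℝ => sqDev m y s) := by
  unfold sqDev
  fun_prop

lemma measurable_atypical (m D : ℝ) (s : ℕ) : Measurable (fun y : ℕ → ℝ => atypical m D y s) := by
  unfold atypical
  have h := measurable_avgReward s
  refine (Measurable.ite (measurableSet_lt measurable_const (measurable_sqDev m s))
    measurable_const measurable_const).add ?_
  fun_prop

lemma idxVar_nonneg (σa : ℝ) (y : ℕ → ℝ) (s : ℕ) : 0 ≤ idxVar σa y s :=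
  div_nonneg (Finset.sum_nonneg fun _ _ => sq_nonneg _) (sq_nonneg _)

lemma sum_sq_augResidual (σa : ℝ) (y : ℕ → ℝ) (s : ℕ) :
    ∑ i ∈ Finset.range (s + 2), augResidual σa y s i ^ 2
      = sqDev (avgReward y s) y s + 2 * (s + 2) * σa ^ 2 := by
  rw [Finset.sum_range_succ, Finset.sum_range_succ]
  have h : ∑ i ∈ Finset.range s, augResidual σa y s i ^ 2 = sqDev (avgReward y s) y s :=
    Finset.sum_congr rfl fun i hi => by simp [augResidual, Finset.mem_range.1 hi]
  have h2 : √((s : ℝ) + 2) ^ 2 = s + 2 := Real.sq_sqrt (by positivity)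
  rw [h]
  simp only [augResidual, lt_irrefl, if_false, if_true, show ¬ s + 1 < s by omega,
    show ¬ s + 1 = s by omega, neg_sq, mul_pow, h2]
  ring

/-- The pseudo residuals alone contribute `2 (s + 2) σa²`, and `2 * 1.7² = 5.78`. This keeps the
index spread out even when the observed rewards are nearly equal. -/
lemma idxVar_ge (y : ℕ → ℝ) (s : ℕ) : 5.78 / ((s : ℝ) + 2) ≤ idxVar 1.7 y s := by
  unfold idxVar
  rw [sum_sq_augResidual]
  have : 0 ≤ sqDev (avgReward y s) y s := Finset.sum_nonneg fun _ _ => sq_nonneg _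
  rw [div_le_div_iff₀ (by positivity) (by positivity)]
  nlinarith [show (0 : ℝ) ≤ s from by positivity, mul_nonneg (show (0 : ℝ) ≤ s from by positivity) this]

/-- The average minimises the sum of squared deviations; the excess at `m` is `s * (avgReward y s -
m)²`. -/
lemma sqDev_avgReward_le (m : ℝ) (y : ℕ → ℝ) (s : ℕ) :
    sqDev (avgReward y s) y s ≤ sqDev m y s := by
  rcases Nat.eq_zero_or_pos s with rfl | hs
  · simp [sqDev]
  have hs' : (0 : ℝ) < s := by exact_mod_cast hs
  have h : ∑ i ∈ Finset.range s, y i = s * avgReward y s := by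
    unfold avgReward
    field_simp
  have key : sqDev m y s = sqDev (avgReward y s) y s + s * (avgReward y s - m) ^ 2 := by
    unfold sqDev
    have : ∀ i, (y i - m) ^ 2 = (y i - avgReward y s) ^ 2 + (2 * (avgReward y s - m) * y i
        + ((avgReward y s - m) ^ 2 - 2 * (avgReward y s - m) * avgReward y s)) := fun i => by ring
    simp_rw [this]
    rw [Finset.sum_add_distrib, Finset.sum_add_distrib, ← Finset.mul_sum, h]
    simp
    ring
  rw [key]
  have := mul_nonneg hs'.le (sq_nonneg (avgReward y s - m))
  linarith

/-- `8 s / (s + 2)² + 5.78 / (s + 2) ≤ 13.78 / s`. -/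
lemma idxVar_le {m : ℝ} {y : ℕ → ℝ} {s : ℕ} (hs : 1 ≤ s) (h : sqDev m y s ≤ 8 * s) :
    idxVar 1.7 y s ≤ 14 / s := by
  unfold idxVar
  rw [sum_sq_augResidual]
  have h1 := (sqDev_avgReward_le m y s).trans h
  have hs' : (1 : ℝ) ≤ s := by exact_mod_cast hs
  rw [div_le_div_iff₀ (by positivity) (by positivity)]
  nlinarith

lemma map_armIndex {Ω : Type*} [MeasurableSpace Ω] {P : Measure Ω}
    [IsProbabilityMeasure P] {X : ℕ → Ω → ℝ} (hX : ∀ i, Measurable (X i))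
    (hlaw : ∀ i, P.map (X i) = gaussianReal 0 1) (hind : iIndepFun X P) (σa : ℝ) (y : ℕ → ℝ)
    (s : ℕ) :
    P.map (fun ω => armIndex σa y s (fun i => X i ω))
      = gaussianReal (avgReward y s) (Real.toNNReal (idxVar σa y s)) := by
  have h := map_sum_mul_gaussianReal hX hlaw hind (augResidual σa y s) (s + 2)
  have e : (fun ω => armIndex σa y s (fun i => X i ω))
      = (fun x => x + avgReward y s) ∘ ((fun x => x / ((s : ℝ) + 2)) ∘
        (fun ω => ∑ i ∈ Finset.range (s + 2), X i ω * augResidual σa y s i)) := by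
    ext ω
    simp [armIndex, add_comm]
  have hm : Measurable (fun ω => ∑ i ∈ Finset.range (s + 2), X i ω * augResidual σa y s i) :=
    Finset.measurable_sum _ fun i _ => (hX i).mul_const _
  rw [e, ← Measure.map_map (by fun_prop) (by fun_prop), ← Measure.map_map (by fun_prop) hm, h,
    gaussianReal_map_div_const, gaussianReal_map_add_const]
  congr 1
  · simp
  · ext
    have := Finset.sum_nonneg fun i (_ : i ∈ Finset.range (s + 2)) =>
      sq_nonneg (augResidual σa y s i)
    rw [Real.coe_toNNReal _ (idxVar_nonneg _ _ _)]
    simp [idxVar, this]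

lemma le_mul_of_le_of_mul_le {p q : ℝ≥0∞} {a b c r : ℝ} (hc : 0 < c) (hr : 0 ≤ r)
    (hp : p ≤ ENNReal.ofReal a) (hq : ENNReal.ofReal (c * b) ≤ q) (h : a ≤ r * b) :
    p ≤ ENNReal.ofReal (c⁻¹ * r) * q := by
  calc p ≤ ENNReal.ofReal a := hp
    _ ≤ ENNReal.ofReal (c⁻¹ * r * (c * b)) := by
        refine ENNReal.ofReal_le_ofReal (h.trans (le_of_eq ?_))
        field_simp
    _ = ENNReal.ofReal (c⁻¹ * r) * ENNReal.ofReal (c * b) := ENNReal.ofReal_mul (by positivity)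
    _ ≤ _ := by gcongr

/-- The source of the rate `448 = 4² * 2 * 14`: a deviation of at least `D / 4` against a variance
of at most `14 / s`. -/
lemma le_exp_of_idxVar_le {x D v : ℝ} {s : ℕ} (hs : 1 ≤ s) (hv : 0 < v) (hv2 : v ≤ 14 / s)
    (hx : (D / 4) ^ 2 ≤ x ^ 2) :
    Real.exp (-x ^ 2 / (2 * v)) ≤ Real.exp (-(s * D ^ 2 / 448)) := by
  have hs' : (1 : ℝ) ≤ s := by exact_mod_cast hs
  gcongr
  rw [neg_div, neg_le_neg_iff, le_div_iff₀ (by positivity)]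
  rw [le_div_iff₀ (by positivity)] at hv2
  nlinarith [sq_nonneg D, mul_le_mul_of_nonneg_left hv2 (sq_nonneg D)]

/-- The odds that the index of an arm stays below its mean reward by `D / 2`. -/
lemma gaussianReal_odds_le {m D : ℝ} (hD : 0 < D) {y : ℕ → ℝ} {s : ℕ} (hs : 1 ≤ s) :
    gaussianReal (avgReward y s) (Real.toNNReal (idxVar 1.7 y s)) (Set.Iic (m - D / 2))
      ≤ ENNReal.ofReal (tailConst⁻¹ * (Real.exp (-(s * D ^ 2 / 448)) + atypical m D y s))
        * gaussianReal (avgReward y s) (Real.toNNReal (idxVar 1.7 y s)) (Set.Ioi (m - D / 2)) := by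
  have hs' : (1 : ℝ) ≤ s := by exact_mod_cast hs
  have hv0 : 0 < idxVar 1.7 y s := lt_of_lt_of_le (by positivity) (idxVar_ge y s)
  have hv : Real.toNNReal (idxVar 1.7 y s) ≠ 0 := by simpa using hv0
  have hvc : (Real.toNNReal (idxVar 1.7 y s) : ℝ) = idxVar 1.7 y s := Real.coe_toNNReal _ hv0.le
  have hr : 0 ≤ Real.exp (-(s * D ^ 2 / 448)) + atypical m D y s :=
    add_nonneg (Real.exp_pos _).le (atypical_nonneg _ _ _ _)
  have hp1 : gaussianReal (avgReward y s) (Real.toNNReal (idxVar 1.7 y s)) (Set.Iic (m - D / 2))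
      ≤ ENNReal.ofReal 1 := by simpa using prob_le_one
  rcases le_or_gt (m - D / 4) (avgReward y s) with hx | hx
  -- The average is not too low: the level lies below the mean of the index, so `z = 0` bounds the
  -- upper tail below by a constant.
  · have hq := gaussianReal_Ioi_ge (m := avgReward y s) hv (τ := m - D / 2) le_rfl (by linarith)
    simp only [ne_eq, OfNat.ofNat_ne_zero, not_false_eq_true, zero_pow, mul_zero, neg_zero,
      Real.exp_zero] at hq
    rcases le_or_gt (sqDev m y s) (8 * s) with hS | hS
    · refine le_mul_of_le_of_mul_le tailConst_pos hr
        (gaussianReal_Iic_le _ hv (by linarith)) hq ?_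
      rw [hvc, mul_one]
      refine (le_exp_of_idxVar_le hs hv0 (idxVar_le hs hS) ?_).trans
        (le_add_of_nonneg_right (atypical_nonneg _ _ _ _))
      nlinarith
    · refine le_mul_of_le_of_mul_le tailConst_pos hr hp1 hq ?_
      have : 1 ≤ atypical m D y s := by
        unfold atypical
        rw [if_pos hS]
        exact le_add_of_nonneg_right (Real.exp_pos _).le
      linarith [Real.exp_pos (-(s * D ^ 2 / 448))]
  -- The average is too low: the lower tail is bounded by `1`, and the upper tail is estimated at
  -- the true mean `m`, which is above the level `m - D / 2`.
  · have hz : 0 ≤ (m - avgReward y s) / √(idxVar 1.7 y s) := by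
      refine div_nonneg ?_ (Real.sqrt_nonneg _)
      linarith
    have hsq : 0 < √(idxVar 1.7 y s) := Real.sqrt_pos.2 hv0
    have hq := gaussianReal_Ioi_ge (m := avgReward y s) hv (τ := m - D / 2) hz (by
      rw [hvc]
      field_simp
      linarith)
    refine le_mul_of_le_of_mul_le tailConst_pos hr hp1 hq ?_
    rw [div_pow, Real.sq_sqrt hv0.le]
    set x := avgReward y s - m with hxdef
    have e : m - avgReward y s = -x := by ring
    -- For `s ≥ 1`, `s + 2 ≤ 3 s`, and `3 / 5.78 < 0.52`.
    have h1 : x ^ 2 / idxVar 1.7 y s ≤ 0.52 * (s * x ^ 2) := by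
      rw [div_le_iff₀ hv0]
      have h2 := idxVar_ge y s
      rw [div_le_iff₀ (by positivity)] at h2
      nlinarith [mul_nonneg (mul_nonneg (sub_nonneg.2 hs') hv0.le) (sq_nonneg x),
        mul_le_mul_of_nonneg_right h2 (sq_nonneg x), mul_nonneg hv0.le (sq_nonneg x)]
    have h3 : D ^ 2 / 16 ≤ x ^ 2 := by
      have : D / 4 ≤ -x := by simp only [hxdef]; linarith
      nlinarith
    have h4 : s * (D ^ 2 / 16) ≤ s * x ^ 2 := by gcongr
    rw [e, neg_sq]
    -- `3 / 4 * 0.52 = 0.39 = 0.44 - 0.05`: the spare `0.05 s x²` is at least `0.05 s D² / 16` by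
    -- `h4`.
    calc (1 : ℝ) ≤ Real.exp (0.44 * (s * x ^ 2) - 0.05 * (s * (D ^ 2 / 16)))
          * Real.exp (-(3 / 4 * (x ^ 2 / idxVar 1.7 y s))) := by
          rw [← Real.exp_add, Real.one_le_exp_iff]
          linarith
      _ ≤ _ := by
          gcongr
          unfold atypical
          have := Real.exp_pos (-(s * D ^ 2 / 448))
          split_ifs <;> linarith

/-- The index of an arm with a typical history rarely exceeds its mean reward by `D / 2`. -/
lemma gaussianReal_Ioi_le_of_typical {m D : ℝ} (hD : 0 < D) {y : ℕ → ℝ} {s : ℕ} (hs : 1 ≤ s)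
    (h : atypical m D y s < 1) :
    gaussianReal (avgReward y s) (Real.toNNReal (idxVar 1.7 y s)) (Set.Ioi (m + D / 2))
      ≤ ENNReal.ofReal (Real.exp (-(s * D ^ 2 / 448))) := by
  have hs' : (1 : ℝ) ≤ s := by exact_mod_cast hs
  have hv0 : 0 < idxVar 1.7 y s := lt_of_lt_of_le (by positivity) (idxVar_ge y s)
  have hv : Real.toNNReal (idxVar 1.7 y s) ≠ 0 := by simpa using hv0
  have hvc : (Real.toNNReal (idxVar 1.7 y s) : ℝ) = idxVar 1.7 y s := Real.coe_toNNReal _ hv0.le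
  unfold atypical at h
  have hS : sqDev m y s ≤ 8 * s := by
    by_contra hS
    rw [if_pos (not_le.1 hS)] at h
    linarith [Real.exp_pos (0.44 * (s * (avgReward y s - m) ^ 2) - 0.05 * (s * (D ^ 2 / 16)))]
  rw [if_neg hS.not_gt, zero_add, Real.exp_lt_one_iff] at h
  -- Now `h` says `0.44 s x² < 0.05 s D² / 16` for `x = avgReward y s - m`.
  have hx : |avgReward y s - m| ≤ D / 4 := by
    refine abs_le_of_sq_le_sq ?_ (by positivity)
    have : (s : ℝ) * (avgReward y s - m) ^ 2 ≤ s * (D / 4) ^ 2 := by nlinarith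
    exact le_of_mul_le_mul_left this (by positivity)
  have hx2 := (abs_le.1 hx).2
  refine (gaussianReal_Ioi_le _ hv (by linarith)).trans (ENNReal.ofReal_le_ofReal ?_)
  rw [hvc]
  refine le_exp_of_idxVar_le hs hv0 (idxVar_le hs hS) ?_
  nlinarith

/-! ### Expected weight of atypical histories -/

section Moments
variable {Ω : Type*} [MeasurableSpace Ω] {P : Measure Ω} {X : ℕ → Ω → ℝ} {m : ℝ}

lemma map_sqrt_mul_avgReward [IsProbabilityMeasure P] (hX : ∀ i, Measurable (X i))
    (hlaw : ∀ i, P.map (X i) = gaussianReal m 1) (hind : iIndepFun X P) {s : ℕ} (hs : 1 ≤ s) :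
    P.map (fun ω => √s * (avgReward (fun i => X i ω) s - m)) = gaussianReal 0 1 := by
  have hs' : (0 : ℝ) < s := by exact_mod_cast hs
  have h := map_sum_mul_gaussianReal hX hlaw hind (fun _ => (√s)⁻¹) s
  have hsq : √(s : ℝ) * √(s : ℝ) = s := Real.mul_self_sqrt hs'.le
  have hsq0 : √(s : ℝ) ≠ 0 := (Real.sqrt_pos.2 hs').ne'
  have e : (fun ω => √s * (avgReward (fun i => X i ω) s - m))
      = (fun x => x - √s * m) ∘ (fun ω => ∑ i ∈ Finset.range s, X i ω * (√s)⁻¹) := by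
    ext ω
    simp only [avgReward, Function.comp_apply, ← Finset.sum_mul]
    rw [mul_sub]
    congr 1
    field_simp
    rw [pow_two, hsq, mul_comm]
  have hm : Measurable (fun ω => ∑ i ∈ Finset.range s, X i ω * (√s)⁻¹) :=
    Finset.measurable_sum _ fun i _ => (hX i).mul_const _
  rw [e, ← Measure.map_map (by fun_prop) hm, h, gaussianReal_map_sub_const]
  congr 1
  · simp only [Finset.sum_const, Finset.card_range, nsmul_eq_mul]
    field_simp
    rw [pow_two, hsq]
    ring
  · simp [hs'.le, hs'.ne']

/-- The exponent is `0.44` times the square of a standard normal variable; `0.44 < 1 / 2` makes the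
moment finite, namely `(1 - 0.88)^(-1/2) < 3`, uniformly in `s`. -/
lemma lintegral_exp_sq_avgReward_le [IsProbabilityMeasure P] (hX : ∀ i, Measurable (X i))
    (hlaw : ∀ i, P.map (X i) = gaussianReal m 1) (hind : iIndepFun X P) {s : ℕ} (hs : 1 ≤ s) :
    ∫⁻ ω, ENNReal.ofReal (Real.exp (0.44 * (s * (avgReward (fun i => X i ω) s - m) ^ 2))) ∂P
      ≤ ENNReal.ofReal 3 := by
  have hmeas : Measurable (fun ω => √s * (avgReward (fun i => X i ω) s - m)) := by
    have := (measurable_avgReward s).comp (measurable_pi_iff.2 hX : Measurable fun ω i => X i ω)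
    simp only [Function.comp_def] at this
    fun_prop
  have h := lintegral_exp_sq_gaussianReal (θ := 0.44) (by norm_num)
  rw [← map_sqrt_mul_avgReward hX hlaw hind hs, lintegral_map (by fun_prop) hmeas] at h
  simp only [mul_pow, Real.sq_sqrt (Nat.cast_nonneg (α := ℝ) s)] at h
  rw [h]
  refine ENNReal.ofReal_le_ofReal ?_
  rw [inv_le_comm₀ (Real.sqrt_pos.2 (by norm_num)) (by norm_num)]
  exact Real.le_sqrt_of_sq_le (by norm_num)

/-- Chernoff bound: each factor `exp ((X i - m)² / 4)` has mean `√2 < e`, and Markov's inequality at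
level `exp (2 s)` leaves `exp (s - 2 s)`. -/
lemma measure_sqDev_le (hX : ∀ i, Measurable (X i))
    (hlaw : ∀ i, P.map (X i) = gaussianReal m 1) (hind : iIndepFun X P) (s : ℕ) :
    P {ω | 8 * s < sqDev m (fun i => X i ω) s} ≤ ENNReal.ofReal (Real.exp (-s)) := by
  set f : ℕ → Ω → ℝ≥0∞ := fun i ω => ENNReal.ofReal (Real.exp (1 / 4 * (X i ω - m) ^ 2))
  have hf : ∀ i, ∫⁻ ω, f i ω ∂P ≤ ENNReal.ofReal (Real.exp 1) := by
    intro i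
    have h := lintegral_exp_sq_gaussianReal (θ := 1 / 4) (by norm_num)
    have h2 : P.map (fun ω => X i ω - m) = gaussianReal 0 1 := by
      have := gaussianReal_map_sub_const (μ := m) (v := 1) m
      rw [← hlaw i, Measure.map_map (by fun_prop) (hX i), sub_self] at this
      exact this
    rw [← h2, lintegral_map (by fun_prop) ((hX i).sub_const m)] at h
    rw [h]
    refine ENNReal.ofReal_le_ofReal ?_
    have : (√(1 - 2 * (1 / 4 : ℝ)))⁻¹ ≤ 2 := by
      rw [inv_le_comm₀ (Real.sqrt_pos.2 (by norm_num)) (by norm_num)]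
      exact Real.le_sqrt_of_sq_le (by norm_num)
    linarith [Real.add_one_le_exp (1 : ℝ)]
  have hi : iIndepFun f P :=
    hind.comp (fun _ x => ENNReal.ofReal (Real.exp (1 / 4 * (x - m) ^ 2))) fun _ => by fun_prop
  have hprod := lintegral_prod_eq_prod_lintegral_of_indepFun (Finset.range s) f hi
    fun i => by have := hX i; fun_prop
  have hle : ∫⁻ ω, ∏ i ∈ Finset.range s, f i ω ∂P ≤ ENNReal.ofReal (Real.exp s) := by
    rw [hprod]
    calc ∏ i ∈ Finset.range s, ∫⁻ ω, f i ω ∂P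
        ≤ ∏ i ∈ Finset.range s, ENNReal.ofReal (Real.exp 1) :=
          Finset.prod_le_prod' fun i _ => hf i
      _ = ENNReal.ofReal (Real.exp s) := by
          rw [Finset.prod_const, Finset.card_range, ← ENNReal.ofReal_pow (Real.exp_pos _).le,
            ← Real.exp_nat_mul, mul_one]
  have hpt : ∀ ω, ∏ i ∈ Finset.range s, f i ω
      = ENNReal.ofReal (Real.exp (1 / 4 * sqDev m (fun i => X i ω) s)) := by
    intro ω
    simp only [f]
    rw [← ENNReal.ofReal_prod_of_nonneg fun i _ => (Real.exp_pos _).le, ← Real.exp_sum, sqDev,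
      Finset.mul_sum]
  have hmk := mul_meas_ge_le_lintegral₀ (μ := P) (f := fun ω => ∏ i ∈ Finset.range s, f i ω)
    (by
      refine (Finset.measurable_prod _ fun i _ => ?_).aemeasurable
      have := hX i
      fun_prop) (ENNReal.ofReal (Real.exp (2 * s)))
  have hsub : {ω | 8 * s < sqDev m (fun i => X i ω) s}
      ⊆ {ω | ENNReal.ofReal (Real.exp (2 * s)) ≤ ∏ i ∈ Finset.range s, f i ω} := by
    intro ω hω
    simp only [Set.mem_ofPred_eq] at hω ⊢
    rw [hpt]
    refine ENNReal.ofReal_le_ofReal (Real.exp_le_exp.2 ?_)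
    linarith
  have h1 : ENNReal.ofReal (Real.exp (2 * s)) * P {ω | 8 * s < sqDev m (fun i => X i ω) s}
      ≤ ENNReal.ofReal (Real.exp s) :=
    (mul_le_mul_right (measure_mono hsub) _).trans (hmk.trans hle)
  calc P {ω | 8 * s < sqDev m (fun i => X i ω) s}
      = ENNReal.ofReal (Real.exp (-(2 * s))) * (ENNReal.ofReal (Real.exp (2 * s))
          * P {ω | 8 * s < sqDev m (fun i => X i ω) s}) := by
        rw [← mul_assoc, ← ENNReal.ofReal_mul (Real.exp_pos _).le, ← Real.exp_add]
        simp
    _ ≤ ENNReal.ofReal (Real.exp (-(2 * s))) * ENNReal.ofReal (Real.exp s) := by gcongr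
    _ = ENNReal.ofReal (Real.exp (-s)) := by
        rw [← ENNReal.ofReal_mul (Real.exp_pos _).le, ← Real.exp_add]
        congr 2
        ring

/-- Both parts of the weight decay at least at the common rate `D² / 448`: the first because `D ≤
1`, the second because `0.05 / 16 = 1 / 320`. The factor is `4 = 1 + 3`. -/
lemma lintegral_atypical_le [IsProbabilityMeasure P] (hX : ∀ i, Measurable (X i))
    (hlaw : ∀ i, P.map (X i) = gaussianReal m 1) (hind : iIndepFun X P) {s : ℕ} (hs : 1 ≤ s)
    {D : ℝ} (hD0 : 0 ≤ D) (hD : D ≤ 1) :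
    ∫⁻ ω, ENNReal.ofReal (atypical m D (fun i => X i ω) s) ∂P
      ≤ ENNReal.ofReal (4 * Real.exp (-(s * D ^ 2 / 448))) := by
  have hD2 : D ^ 2 ≤ 1 := by nlinarith
  have hs0 : (0 : ℝ) ≤ s := by positivity
  have hsD : 0 ≤ s * D ^ 2 := by positivity
  have hsD' : s * D ^ 2 ≤ s := by nlinarith
  have hXm : Measurable fun ω i => X i ω := measurable_pi_iff.2 hX
  have hm1 : Measurable (fun ω => avgReward (fun i => X i ω) s) :=
    (measurable_avgReward s).comp hXm
  have hset : MeasurableSet {ω | 8 * s < sqDev m (fun i => X i ω) s} :=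
    measurableSet_lt measurable_const ((measurable_sqDev m s).comp hXm)
  have hpt : ∀ ω, ENNReal.ofReal (atypical m D (fun i => X i ω) s)
      = Set.indicator {ω | 8 * s < sqDev m (fun i => X i ω) s} 1 ω
        + ENNReal.ofReal (Real.exp (-(0.05 * (s * (D ^ 2 / 16)))))
          * ENNReal.ofReal (Real.exp (0.44 * (s * (avgReward (fun i => X i ω) s - m) ^ 2))) := by
    intro ω
    unfold atypical
    rw [ENNReal.ofReal_add (by split_ifs <;> norm_num) (Real.exp_pos _).le,
      ← ENNReal.ofReal_mul (Real.exp_pos _).le, ← Real.exp_add]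
    congr 1
    · simp only [Set.indicator_apply, Set.mem_ofPred_eq]
      split_ifs <;> simp
    · congr 2
      ring
  simp_rw [hpt]
  rw [lintegral_add_left (measurable_one.indicator hset), lintegral_indicator_one hset,
    lintegral_const_mul _ (by fun_prop)]
  calc _ ≤ ENNReal.ofReal (Real.exp (-s))
        + ENNReal.ofReal (Real.exp (-(0.05 * (s * (D ^ 2 / 16))))) * ENNReal.ofReal 3 := by
        gcongr
        · exact measure_sqDev_le hX hlaw hind s
        · exact lintegral_exp_sq_avgReward_le hX hlaw hind hs
    _ ≤ _ := by
        rw [← ENNReal.ofReal_mul (Real.exp_pos _).le,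
          ← ENNReal.ofReal_add (Real.exp_pos _).le (by positivity)]
        refine ENNReal.ofReal_le_ofReal ?_
        have h1 : Real.exp (-s) ≤ Real.exp (-(s * D ^ 2 / 448)) := by
          gcongr
          linarith
        have h2 : Real.exp (-(0.05 * (s * (D ^ 2 / 16)))) ≤ Real.exp (-(s * D ^ 2 / 448)) := by
          gcongr
          linarith
        linarith

end Moments

/-- The geometric series has sum `1 / (exp a - 1)`. -/
lemma tsum_exp_neg_le {a : ℝ} (ha : 0 < a) :
    ∑' s : ℕ, ENNReal.ofReal (Real.exp (-(((s + 1 : ℕ) : ℝ) * a))) ≤ ENNReal.ofReal (1 / a) := by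
  have hq : Real.exp (-a) < 1 := by simpa using ha
  have hpos := Real.exp_pos (-a)
  have e : ∀ s : ℕ, Real.exp (-(((s + 1 : ℕ) : ℝ) * a)) = Real.exp (-a) * Real.exp (-a) ^ s := by
    intro s
    rw [← Real.exp_nat_mul, ← Real.exp_add]
    congr 1
    push_cast
    ring
  simp_rw [e]
  rw [← ENNReal.ofReal_tsum_of_nonneg (fun s => by positivity)
    ((summable_geometric_of_lt_one hpos.le hq).mul_left _), tsum_mul_left,
    tsum_geometric_of_lt_one hpos.le hq]
  refine ENNReal.ofReal_le_ofReal ?_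
  rw [← div_eq_mul_inv, div_le_div_iff₀ (by linarith) ha]
  have h1 : Real.exp (-a) * Real.exp a = 1 := by rw [← Real.exp_add]; simp
  nlinarith [Real.add_one_le_exp a]

/-! ### Independence and freezing of variables -/

lemma indepFun_of_measurable_iSup {Ω ι α β : Type*} [MeasurableSpace Ω] [MeasurableSpace α]
    [MeasurableSpace β] {P : Measure Ω} {X : ι → Ω → ℝ} (hX : ∀ i, Measurable (X i))
    (hind : iIndepFun X P) (S : Set ι) {A : Ω → α} {B : Ω → β}
    (hA : Measurable[⨆ i ∈ S, MeasurableSpace.comap (X i) inferInstance] A)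
    (hB : Measurable[⨆ i ∈ Sᶜ, MeasurableSpace.comap (X i) inferInstance] B) :
    IndepFun A B P := by
  rw [IndepFun_iff_Indep]
  have h := indep_iSup_of_disjoint (fun i => (hX i).comap_le) hind
    (disjoint_compl_right (a := S))
  exact indep_of_indep_of_le_left (indep_of_indep_of_le_right h hB.comap_le) hA.comap_le

lemma measurable_iSup_comap {Ω ι : Type*} {X : ι → Ω → ℝ} {S : Set ι} {i : ι} (hi : i ∈ S) :
    Measurable[⨆ i ∈ S, MeasurableSpace.comap (X i) inferInstance] (X i) :=
  (comap_measurable (X i)).mono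
    (le_iSup₂ (f := fun i (_ : i ∈ S) => MeasurableSpace.comap (X i) inferInstance) i hi) le_rfl

lemma measurable_seq {Ω : Type*} {_ : MeasurableSpace Ω} {X : ℕ → Ω → ℝ}
    (hX : ∀ i, Measurable (X i)) : Measurable (fun ω i => X i ω) :=
  measurable_pi_iff.2 hX

lemma measurable_history {K : ℕ} {Ω : Type*} {_ : MeasurableSpace Ω} {Y : Fin K → ℕ → Ω → ℝ}
    {w : ℕ → Fin K → ℕ → Ω → ℝ} (hY : ∀ k i, Measurable (Y k i))
    (hw : ∀ t k i, Measurable (w t k i)) :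
    Measurable (fun ω => ((fun k i => Y k i ω : Fin K → ℕ → ℝ),
      (fun t k i => w t k i ω : ℕ → Fin K → ℕ → ℝ))) :=
  (measurable_pi_iff.2 fun k => measurable_seq (hY k)).prodMk
    (measurable_pi_iff.2 fun t => measurable_pi_iff.2 fun k => measurable_seq (hw t k))

lemma measurable_ite_zero {Ω : Type*} {_ : MeasurableSpace Ω} {p : Prop} [Decidable p]
    {f : Ω → ℝ} (hf : ¬ p → Measurable f) : Measurable (fun ω => if p then 0 else f ω) := by
  split_ifs with h
  · exact measurable_const
  · exact hf h

lemma lintegral_of_indepFun {Ω α β : Type*} [MeasurableSpace Ω] [MeasurableSpace α]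
    [MeasurableSpace β] {P : Measure Ω} [IsProbabilityMeasure P] {A : Ω → α} {B : Ω → β}
    (hA : Measurable A) (hB : Measurable B) (h : IndepFun A B P) {f : α → β → ℝ≥0∞}
    (hf : Measurable (Function.uncurry f)) :
    ∫⁻ ω, f (A ω) (B ω) ∂P = ∫⁻ ω, ∫⁻ ω', f (A ω') (B ω) ∂P ∂P := by
  have h1 := (indepFun_iff_map_prod_eq_prod_map_map hA.aemeasurable hB.aemeasurable).1 h
  have h2 : ∫⁻ ω, f (A ω) (B ω) ∂P
      = ∫⁻ p, Function.uncurry f p ∂(P.map (fun ω => (A ω, B ω))) := by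
    rw [lintegral_map hf (hA.prodMk hB)]
    rfl
  have := Measure.isProbabilityMeasure_map (μ := P) hA.aemeasurable
  have := Measure.isProbabilityMeasure_map (μ := P) hB.aemeasurable
  rw [h2, h1, lintegral_prod_symm' _ hf, lintegral_map hf.lintegral_prod_left' hB]
  refine lintegral_congr fun ω => ?_
  exact lintegral_map (hf.comp measurable_prodMk_right) hA

namespace IsGaussianBandit
variable {K : ℕ} {Ω : Type*} [MeasurableSpace Ω] {P : Measure Ω}
  {μ : Fin K → ℝ} {Y : Fin K → ℕ → Ω → ℝ} {w : ℕ → Fin K → ℕ → Ω → ℝ}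

lemma measurable_elim (h : IsGaussianBandit P μ Y w) :
    ∀ i, Measurable (Sum.elim (fun p : Fin K × ℕ => Y p.1 p.2)
      (fun q : ℕ × Fin K × ℕ => w q.1 q.2.1 q.2.2) i)
  | .inl p => h.measurable_reward p.1 p.2
  | .inr q => h.measurable_weight q.1 q.2.1 q.2.2

lemma iIndepFun_reward (h : IsGaussianBandit P μ Y w) (k : Fin K) : iIndepFun (Y k) P :=
  h.indep.precomp (g := fun i : ℕ => (Sum.inl (k, i) : (Fin K × ℕ) ⊕ (ℕ × Fin K × ℕ)))
    (fun _ _ e => by simpa using e)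

lemma iIndepFun_weight (h : IsGaussianBandit P μ Y w) (t : ℕ) (k : Fin K) :
    iIndepFun (w t k) P :=
  h.indep.precomp (g := fun i : ℕ => (Sum.inr (t, k, i) : (Fin K × ℕ) ⊕ (ℕ × Fin K × ℕ)))
    (fun _ _ e => by simpa using e)

/-- The weights of arm `k` in round `t` are independent of everything else. -/
lemma indepFun_weight (h : IsGaussianBandit P μ Y w) (t : ℕ) (k : Fin K) :
    IndepFun (fun ω i => w t k i ω)
      (fun ω => ((fun j i => Y j i ω : Fin K → ℕ → ℝ),
        (fun t' j i => if t' = t ∧ j = k then 0 else w t' j i ω : ℕ → Fin K → ℕ → ℝ))) P := by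
  refine indepFun_of_measurable_iSup h.measurable_elim h.indep
    (Set.range fun i => Sum.inr (t, k, i)) (measurable_seq fun i => ?_)
    (measurable_history (fun j i => ?_)
      (w := fun t' j i ω => if t' = t ∧ j = k then 0 else w t' j i ω)
      (fun t' j i => measurable_ite_zero fun hc => ?_))
  · exact measurable_iSup_comap (X := Sum.elim (fun p : Fin K × ℕ => Y p.1 p.2)
      (fun q : ℕ × Fin K × ℕ => w q.1 q.2.1 q.2.2)) (i := Sum.inr (t, k, i)) ⟨i, rfl⟩
  · exact measurable_iSup_comap (X := Sum.elim (fun p : Fin K × ℕ => Y p.1 p.2)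
      (fun q : ℕ × Fin K × ℕ => w q.1 q.2.1 q.2.2)) (i := Sum.inl (j, i)) (by simp)
  · refine measurable_iSup_comap (X := Sum.elim (fun p : Fin K × ℕ => Y p.1 p.2)
      (fun q : ℕ × Fin K × ℕ => w q.1 q.2.1 q.2.2)) (i := Sum.inr (t', j, i)) ?_
    rintro ⟨i', e⟩
    simp only [Sum.inr.injEq, Prod.mk.injEq] at e
    exact hc ⟨e.1.symm, e.2.1.symm⟩

/-- The reward number `s` of arm `k` is independent of everything else. -/
lemma indepFun_reward (h : IsGaussianBandit P μ Y w) (k : Fin K) (s : ℕ) :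
    IndepFun (Y k s)
      (fun ω => ((fun j i => if j = k ∧ i = s then 0 else Y j i ω : Fin K → ℕ → ℝ),
        (fun t j i => w t j i ω : ℕ → Fin K → ℕ → ℝ))) P := by
  refine indepFun_of_measurable_iSup h.measurable_elim h.indep {Sum.inl (k, s)} ?_
    (measurable_history (Y := fun j i ω => if j = k ∧ i = s then 0 else Y j i ω)
      (fun j i => measurable_ite_zero fun hc => ?_) (fun t' j i => ?_))
  · exact measurable_iSup_comap (X := Sum.elim (fun p : Fin K × ℕ => Y p.1 p.2)
      (fun q : ℕ × Fin K × ℕ => w q.1 q.2.1 q.2.2)) (i := Sum.inl (k, s)) rfl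
  · refine measurable_iSup_comap (X := Sum.elim (fun p : Fin K × ℕ => Y p.1 p.2)
      (fun q : ℕ × Fin K × ℕ => w q.1 q.2.1 q.2.2)) (i := Sum.inl (j, i)) ?_
    simpa using hc
  · exact measurable_iSup_comap (X := Sum.elim (fun p : Fin K × ℕ => Y p.1 p.2)
      (fun q : ℕ × Fin K × ℕ => w q.1 q.2.1 q.2.2)) (i := Sum.inr (t', j, i)) (by simp)

lemma measurable_armIndex_weight (h : IsGaussianBandit P μ Y w) (t : ℕ) (k : Fin K) (σa : ℝ)
    (y : ℕ → ℝ) (s : ℕ) : Measurable (fun ω => armIndex σa y s (fun i => w t k i ω)) :=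
  measurable_armIndex' measurable_const measurable_const
    (measurable_pi_iff.2 fun i => h.measurable_weight t k i)

variable [IsProbabilityMeasure P]

lemma map_armIndex_weight (h : IsGaussianBandit P μ Y w) (t : ℕ) (k : Fin K) (σa : ℝ)
    (y : ℕ → ℝ) (s : ℕ) :
    P.map (fun ω => armIndex σa y s (fun i => w t k i ω))
      = gaussianReal (avgReward y s) (Real.toNNReal (idxVar σa y s)) :=
  map_armIndex (h.measurable_weight t k) (h.law_weight t k) (h.iIndepFun_weight t k) σa y s

/-- Integrals over the weights of arm `k` in round `t` can be compared with everything else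
being fixed. -/
lemma lintegral_weight_mono (h : IsGaussianBandit P μ Y w) (t : ℕ) (k : Fin K)
    {f g : (ℕ → ℝ) → (Fin K → ℕ → ℝ) × (ℕ → Fin K → ℕ → ℝ) → ℝ≥0∞}
    (hf : Measurable (Function.uncurry f)) (hg : Measurable (Function.uncurry g))
    (hfg : ∀ b, ∫⁻ ω, f (fun i => w t k i ω) b ∂P ≤ ∫⁻ ω, g (fun i => w t k i ω) b ∂P) :
    ∫⁻ ω, f (fun i => w t k i ω) (fun j i => Y j i ω,
        fun t' j i => if t' = t ∧ j = k then 0 else w t' j i ω) ∂P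
      ≤ ∫⁻ ω, g (fun i => w t k i ω) (fun j i => Y j i ω,
        fun t' j i => if t' = t ∧ j = k then 0 else w t' j i ω) ∂P := by
  have hA : Measurable (fun ω i => w t k i ω) :=
    measurable_pi_iff.2 fun i => h.measurable_weight t k i
  have hB := measurable_history h.measurable_reward
    (w := fun t' j i ω => if t' = t ∧ j = k then 0 else w t' j i ω)
    (fun t' j i => measurable_ite_zero fun _ => h.measurable_weight t' j i)
  rw [lintegral_of_indepFun hA hB (h.indepFun_weight t k) hf,
    lintegral_of_indepFun hA hB (h.indepFun_weight t k) hg]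
  exact lintegral_mono fun ω => hfg _

end IsGaussianBandit

/-! ### One-round estimates, integrating out the weights of one arm -/

/-- The index of arm `k` in round `t`. -/
def roundIndex {K : ℕ} (σa : ℝ) (sel : (Fin K → ℝ) → Fin K) (Y : Fin K → ℕ → ℝ)
    (w : ℕ → Fin K → ℕ → ℝ) (t : ℕ) (k : Fin K) : ℝ :=
  armIndex σa (Y k) (pulls σa sel Y w t k) (w t k)

/-- The bound for the odds that the index of an arm stays below its mean reward `m` by `D / 2`. -/
def oddsBound (m D : ℝ) (y : ℕ → ℝ) (s : ℕ) : ℝ≥0∞ :=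
  ENNReal.ofReal (tailConst⁻¹ * (Real.exp (-(s * D ^ 2 / 448)) + atypical m D y s))

lemma measurable_oddsBound (m D : ℝ) (s : ℕ) :
    Measurable (fun y : ℕ → ℝ => oddsBound m D y s) := by
  unfold oddsBound
  have := measurable_atypical m D s
  fun_prop

section Masking
variable {K : ℕ} {σa : ℝ} {sel : (Fin K → ℝ) → Fin K} {Y : Fin K → ℕ → ℝ}
  {w : ℕ → Fin K → ℕ → ℝ}

lemma pulls_mask (t : ℕ) (k : Fin K) :
    pulls σa sel Y (fun t' j i => if t' = t ∧ j = k then 0 else w t' j i) t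
      = pulls σa sel Y w t := by
  refine pulls_congr_weight fun t' ht' => ?_
  funext j i
  simp [ht'.ne]

/-- Zeroing the weights of arm `k` in round `t` leaves the other indices unchanged, so these are
functions of data independent of those weights. -/
lemma roundIndex_mask {t : ℕ} {k j : Fin K} (hj : j ≠ k) :
    roundIndex σa sel Y (fun t' j i => if t' = t ∧ j = k then 0 else w t' j i) t j
      = roundIndex σa sel Y w t j := by
  unfold roundIndex
  rw [pulls_mask]
  simp [hj]

lemma measurable_pulls_apply (hsel : Measurable sel) (t : ℕ) (k : Fin K) :
    Measurable (fun p : (Fin K → ℕ → ℝ) × (ℕ → Fin K → ℕ → ℝ) => pulls σa sel p.1 p.2 t k) :=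
  (measurable_pi_apply k).comp (measurable_arm_pulls hsel t).2

lemma measurable_roundIndex (hsel : Measurable sel) (t : ℕ) (k : Fin K) :
    Measurable (fun p : (Fin K → ℕ → ℝ) × (ℕ → Fin K → ℕ → ℝ) =>
      roundIndex σa sel p.1 p.2 t k) :=
  measurable_armIndex' (by fun_prop) (measurable_pulls_apply hsel t k) (by fun_prop)

lemma measurable_comp_pulls {M : Type*} [MeasurableSpace M] (hsel : Measurable sel) (t : ℕ)
    (k : Fin K) {F : (ℕ → ℝ) → ℕ → M} (hF : ∀ s, Measurable fun y => F y s) :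
    Measurable (fun p : (Fin K → ℕ → ℝ) × (ℕ → Fin K → ℕ → ℝ) =>
      F (p.1 k) (pulls σa sel p.1 p.2 t k)) :=
  (measurable_from_prod_countable_left (f := fun p : (ℕ → ℝ) × ℕ => F p.1 p.2) hF).comp
    (Measurable.prodMk (by fun_prop) (measurable_pulls_apply hsel t k))

end Masking

namespace IsGaussianBandit
variable {K : ℕ} {Ω : Type*} [MeasurableSpace Ω] {P : Measure Ω} [IsProbabilityMeasure P]
  {μ : Fin K → ℝ} {Y : Fin K → ℕ → Ω → ℝ} {w : ℕ → Fin K → ℕ → Ω → ℝ}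
  {sel : (Fin K → ℝ) → Fin K}

lemma measure_armIndex_preimage (h : IsGaussianBandit P μ Y w) (t : ℕ) (k : Fin K) (σa : ℝ)
    (y : ℕ → ℝ) (s : ℕ) {S : Set ℝ} (hS : MeasurableSet S) :
    P ((fun ω => armIndex σa y s (fun i => w t k i ω)) ⁻¹' S)
      = gaussianReal (avgReward y s) (Real.toNNReal (idxVar σa y s)) S := by
  rw [← h.map_armIndex_weight t k σa y s,
    Measure.map_apply (h.measurable_armIndex_weight t k σa y s) hS]

/-- The event that all indices are small is charged to the event that arm `k` is pulled. -/
lemma measure_forall_roundIndex_le (h : IsGaussianBandit P μ Y w) (hsel : Measurable sel)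
    (hmax : IsArgmaxRule sel) {t : ℕ} (ht : K ≤ t) (k : Fin K) {D : ℝ} (hD : 0 < D) :
    P {ω | ∀ j, roundIndex 1.7 sel (fun k i => Y k i ω) (fun t k i => w t k i ω) t j
        ≤ μ k - D / 2}
      ≤ ∫⁻ ω, (if arm 1.7 sel (fun k i => Y k i ω) (fun t k i => w t k i ω) t = k then
          oddsBound (μ k) D (fun i => Y k i ω)
            (pulls 1.7 sel (fun k i => Y k i ω) (fun t k i => w t k i ω) t k) else 0) ∂P := by
  classical
  set τ := μ k - D / 2
  -- `O` does not involve the weights of arm `k` in round `t`. Given the rest, `f` and `g` compare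
  -- the lower and the upper tail of the index of `k`; on `O`, an index above `τ` forces arm `k` to
  -- be pulled.
  let O : (Fin K → ℕ → ℝ) × (ℕ → Fin K → ℕ → ℝ) → Prop :=
    fun b => ∀ j, j ≠ k → roundIndex 1.7 sel b.1 b.2 t j ≤ τ
  let f : (ℕ → ℝ) → (Fin K → ℕ → ℝ) × (ℕ → Fin K → ℕ → ℝ) → ℝ≥0∞ := fun a b =>
    if armIndex 1.7 (b.1 k) (pulls 1.7 sel b.1 b.2 t k) a ≤ τ ∧ O b then 1 else 0
  let g : (ℕ → ℝ) → (Fin K → ℕ → ℝ) × (ℕ → Fin K → ℕ → ℝ) → ℝ≥0∞ := fun a b =>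
    if τ < armIndex 1.7 (b.1 k) (pulls 1.7 sel b.1 b.2 t k) a ∧ O b then
      oddsBound (μ k) D (b.1 k) (pulls 1.7 sel b.1 b.2 t k) else 0
  have hO : MeasurableSet {b | O b} := by
    have : {b | O b} = ⋂ j, ⋂ (_ : j ≠ k), {b | roundIndex 1.7 sel b.1 b.2 t j ≤ τ} := by
      ext b; simp [O]
    rw [this]
    exact MeasurableSet.iInter fun j => MeasurableSet.iInter fun _ =>
      measurableSet_le (measurable_roundIndex hsel t j) measurable_const
  have hidx : Measurable (fun p : (ℕ → ℝ) × (Fin K → ℕ → ℝ) × (ℕ → Fin K → ℕ → ℝ) =>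
      armIndex 1.7 (p.2.1 k) (pulls 1.7 sel p.2.1 p.2.2 t k) p.1) :=
    measurable_armIndex' (by fun_prop)
      ((measurable_pulls_apply hsel t k).comp measurable_snd) measurable_fst
  have hf : Measurable (Function.uncurry f) :=
    Measurable.ite ((measurableSet_le hidx measurable_const).inter (measurable_snd hO))
      measurable_const measurable_const
  have hg : Measurable (Function.uncurry g) :=
    Measurable.ite ((measurableSet_lt measurable_const hidx).inter (measurable_snd hO))
      ((measurable_comp_pulls hsel t k (measurable_oddsBound (μ k) D)).comp measurable_snd)
      measurable_const
  have key := h.lintegral_weight_mono t k hf hg (fun b => by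
    by_cases hb : O b
    · have e1 : ∀ ω, f (fun i => w t k i ω) b = Set.indicator
          ((fun ω => armIndex 1.7 (b.1 k) (pulls 1.7 sel b.1 b.2 t k) (fun i => w t k i ω)) ⁻¹'
            Set.Iic τ) 1 ω := fun ω => by
        simp [f, hb, Set.indicator_apply]
      have e2 : ∀ ω, g (fun i => w t k i ω) b = Set.indicator
          ((fun ω => armIndex 1.7 (b.1 k) (pulls 1.7 sel b.1 b.2 t k) (fun i => w t k i ω)) ⁻¹'
            Set.Ioi τ) (fun _ => oddsBound (μ k) D (b.1 k) (pulls 1.7 sel b.1 b.2 t k)) ω :=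
        fun ω => by simp [g, hb, Set.indicator_apply]
      simp_rw [e1, e2]
      have hm := h.measurable_armIndex_weight t k 1.7 (b.1 k) (pulls 1.7 sel b.1 b.2 t k)
      rw [lintegral_indicator_one (hm measurableSet_Iic),
        lintegral_indicator_const (hm measurableSet_Ioi),
        h.measure_armIndex_preimage t k 1.7 _ _ measurableSet_Iic,
        h.measure_armIndex_preimage t k 1.7 _ _ measurableSet_Ioi]
      exact gaussianReal_odds_le hD (pulls_pos ht k)
    · simp [f, g, hb])
  have hmeas : MeasurableSet {ω | ∀ j, roundIndex 1.7 sel (fun k i => Y k i ω)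
      (fun t k i => w t k i ω) t j ≤ τ} := by
    have : {ω | ∀ j, roundIndex 1.7 sel (fun k i => Y k i ω) (fun t k i => w t k i ω) t j ≤ τ}
        = ⋂ j, {ω | roundIndex 1.7 sel (fun k i => Y k i ω) (fun t k i => w t k i ω) t j ≤ τ} := by
      ext ω; simp
    rw [this]
    exact MeasurableSet.iInter fun j => measurableSet_le ((measurable_roundIndex hsel t j).comp
      (measurable_history h.measurable_reward h.measurable_weight)) measurable_const
  rw [← lintegral_indicator_one hmeas]
  refine (lintegral_mono fun ω => ?_).trans (key.trans (lintegral_mono fun ω => ?_))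
  · rw [Set.indicator_apply]
    split_ifs with hω
    · simp only [f]
      rw [if_pos]
      · simp
      · refine ⟨?_, fun j hj => ?_⟩
        · rw [pulls_mask]
          exact hω k
        · rw [roundIndex_mask hj]
          exact hω j
    · exact zero_le
  · simp only [g]
    split_ifs with h1 h2
    · rw [pulls_mask]
    -- If another arm were pulled, its index would be at most `τ` by `O`, yet at least the index of
    -- `k`, which exceeds `τ`.
    · refine absurd ?_ h2
      obtain ⟨h3, h4⟩ := h1
      rw [pulls_mask] at h3
      rw [arm_of_le ht]
      by_contra hne
      have h5 := h4 _ hne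
      rw [roundIndex_mask hne] at h5
      exact absurd ((hmax _ k).trans h5) (not_le.2 h3)
    all_goals exact zero_le

/-- An arm with a typical history rarely has a large index. -/
lemma measure_typical_lt_roundIndex (h : IsGaussianBandit P μ Y w) (hsel : Measurable sel)
    (t : ℕ) (k : Fin K) {D : ℝ} (hD : 0 < D) {L : ℕ} (hL : 1 ≤ L) :
    P {ω | L ≤ pulls 1.7 sel (fun k i => Y k i ω) (fun t k i => w t k i ω) t k ∧
        atypical (μ k) D (fun i => Y k i ω)
          (pulls 1.7 sel (fun k i => Y k i ω) (fun t k i => w t k i ω) t k) < 1 ∧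
        μ k + D / 2 < roundIndex 1.7 sel (fun k i => Y k i ω) (fun t k i => w t k i ω) t k}
      ≤ ENNReal.ofReal (Real.exp (-(L * D ^ 2 / 448))) := by
  classical
  set τ := μ k + D / 2
  let O : (Fin K → ℕ → ℝ) × (ℕ → Fin K → ℕ → ℝ) → Prop :=
    fun b => L ≤ pulls 1.7 sel b.1 b.2 t k ∧
      atypical (μ k) D (b.1 k) (pulls 1.7 sel b.1 b.2 t k) < 1
  let f : (ℕ → ℝ) → (Fin K → ℕ → ℝ) × (ℕ → Fin K → ℕ → ℝ) → ℝ≥0∞ := fun a b =>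
    if τ < armIndex 1.7 (b.1 k) (pulls 1.7 sel b.1 b.2 t k) a ∧ O b then 1 else 0
  have hO : MeasurableSet {b | O b} :=
    (measurableSet_le measurable_const (measurable_pulls_apply hsel t k)).inter
      (measurableSet_lt (measurable_comp_pulls hsel t k (measurable_atypical (μ k) D))
        measurable_const)
  have hidx : Measurable (fun p : (ℕ → ℝ) × (Fin K → ℕ → ℝ) × (ℕ → Fin K → ℕ → ℝ) =>
      armIndex 1.7 (p.2.1 k) (pulls 1.7 sel p.2.1 p.2.2 t k) p.1) :=
    measurable_armIndex' (by fun_prop)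
      ((measurable_pulls_apply hsel t k).comp measurable_snd) measurable_fst
  have hf : Measurable (Function.uncurry f) :=
    Measurable.ite ((measurableSet_lt measurable_const hidx).inter (measurable_snd hO))
      measurable_const measurable_const
  have key := h.lintegral_weight_mono t k hf
    (g := fun _ _ => ENNReal.ofReal (Real.exp (-(L * D ^ 2 / 448)))) measurable_const (fun b => by
    by_cases hb : O b
    · have e1 : ∀ ω, f (fun i => w t k i ω) b = Set.indicator
          ((fun ω => armIndex 1.7 (b.1 k) (pulls 1.7 sel b.1 b.2 t k) (fun i => w t k i ω)) ⁻¹'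
            Set.Ioi τ) 1 ω := fun ω => by
        simp [f, hb, Set.indicator_apply]
      simp_rw [e1]
      have hm := h.measurable_armIndex_weight t k 1.7 (b.1 k) (pulls 1.7 sel b.1 b.2 t k)
      rw [lintegral_indicator_one (hm measurableSet_Ioi),
        h.measure_armIndex_preimage t k 1.7 _ _ measurableSet_Ioi, lintegral_const, measure_univ,
        mul_one]
      refine (gaussianReal_Ioi_le_of_typical hD (hL.trans hb.1) hb.2).trans
        (ENNReal.ofReal_le_ofReal ?_)
      have := hb.1
      gcongr
    · simp [f, hb])
  rw [lintegral_const, measure_univ, mul_one] at key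
  refine le_trans ?_ key
  have hmeas : MeasurableSet {ω | L ≤ pulls 1.7 sel (fun k i => Y k i ω)
        (fun t k i => w t k i ω) t k ∧ atypical (μ k) D (fun i => Y k i ω)
          (pulls 1.7 sel (fun k i => Y k i ω) (fun t k i => w t k i ω) t k) < 1 ∧
        τ < roundIndex 1.7 sel (fun k i => Y k i ω) (fun t k i => w t k i ω) t k} := by
    have hh := measurable_history h.measurable_reward h.measurable_weight
    exact (measurableSet_le measurable_const ((measurable_pulls_apply hsel t k).comp hh)).inter
      ((measurableSet_lt ((measurable_comp_pulls hsel t k (measurable_atypical (μ k) D)).comp hh)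
        measurable_const).inter
        (measurableSet_lt measurable_const ((measurable_roundIndex hsel t k).comp hh)))
  rw [← lintegral_indicator_one hmeas]
  refine lintegral_mono fun ω => ?_
  rw [Set.indicator_apply]
  split_ifs with hω
  · obtain ⟨h1, h2, h3⟩ := hω
    simp only [f]
    rw [if_pos]
    · simp
    · simp only [O]
      rw [pulls_mask]
      exact ⟨h3, h1, h2⟩
  · exact zero_le

end IsGaussianBandit

/-! ### The expected number of pulls of a suboptimal arm -/

lemma pulls_le {K : ℕ} {σa : ℝ} {sel : (Fin K → ℝ) → Fin K} {Y : Fin K → ℕ → ℝ}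
    {w : ℕ → Fin K → ℕ → ℝ} (t : ℕ) (k : Fin K) : pulls σa sel Y w t k ≤ t := by
  rw [pulls_eq_sum]
  calc _ ≤ ∑ _t ∈ Finset.range t, 1 := Finset.sum_le_sum fun _ _ => by split_ifs <;> simp
    _ = t := by simp

lemma tsum_lintegral_ite_zero {α : Type*} [MeasurableSpace α] (ν : Measure α)
    (G : ℕ → α → ℝ≥0∞) :
    ∑' s, ∫⁻ a, (if s = 0 then 0 else G s a) ∂ν = ∑' s, ∫⁻ a, G (s + 1) a ∂ν := by
  rw [tsum_eq_zero_add' ENNReal.summable]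
  simp

/-- The weight given to pull number `s` of a suboptimal arm. -/
def pullWeight (L : ℕ) (m D : ℝ) (y : ℕ → ℝ) (s : ℕ) : ℝ≥0∞ :=
  -- The moment bounds need `s ≥ 1`; for `L ≥ 1` the case `s = 0` is covered by the first summand.
  (if s < L then 1 else 0) + (if s = 0 then 0 else ENNReal.ofReal (atypical m D y s))

lemma measurable_pullWeight (L : ℕ) (m D : ℝ) (s : ℕ) :
    Measurable (fun y : ℕ → ℝ => pullWeight L m D y s) := by
  unfold pullWeight
  have := measurable_atypical m D s
  split_ifs <;> fun_prop

namespace IsGaussianBandit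
variable {K : ℕ} {Ω : Type*} [MeasurableSpace Ω] {P : Measure Ω} {μ : Fin K → ℝ}
  {Y : Fin K → ℕ → Ω → ℝ} {w : ℕ → Fin K → ℕ → Ω → ℝ} {sel : (Fin K → ℝ) → Fin K}

lemma measurable_arm_apply (h : IsGaussianBandit P μ Y w) (hsel : Measurable sel) (σa : ℝ)
    (t : ℕ) : Measurable (fun ω => arm σa sel (fun k i => Y k i ω) (fun t k i => w t k i ω) t) :=
  (measurable_arm_pulls hsel t).1.comp (measurable_history h.measurable_reward h.measurable_weight)

lemma measurable_comp_reward {M : Type*} [MeasurableSpace M] (h : IsGaussianBandit P μ Y w)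
    (k : Fin K) {F : (ℕ → ℝ) → M} (hF : Measurable F) :
    Measurable (fun ω => F (fun i => Y k i ω)) :=
  hF.comp (measurable_seq (h.measurable_reward k))

lemma measurable_ite_arm (h : IsGaussianBandit P μ Y w) (hsel : Measurable sel) (σa : ℝ)
    {F : (ℕ → ℝ) → ℕ → ℝ≥0∞} (hF : ∀ s, Measurable fun y => F y s) (t : ℕ) (k : Fin K) :
    Measurable (fun ω => if arm σa sel (fun k i => Y k i ω) (fun t k i => w t k i ω) t = k then
      F (fun i => Y k i ω) (pulls σa sel (fun k i => Y k i ω) (fun t k i => w t k i ω) t k)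
      else 0) :=
  Measurable.ite (h.measurable_arm_apply hsel σa t (measurableSet_singleton k))
    ((measurable_comp_pulls hsel t k hF).comp
      (measurable_history h.measurable_reward h.measurable_weight)) measurable_const

/-- The rounds that pull arm `k` meet each count `s` at most once. On the right `s` is
deterministic, so the first `s` rewards are again independent Gaussians and the adaptivity has
disappeared. -/
lemma sum_lintegral_ite_arm_le (h : IsGaussianBandit P μ Y w) (hsel : Measurable sel) (σa : ℝ)
    {F : (ℕ → ℝ) → ℕ → ℝ≥0∞} (hF : ∀ s, Measurable fun y => F y s) (k : Fin K) (T : ℕ) :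
    ∑ t ∈ Finset.range T, ∫⁻ ω,
      (if arm σa sel (fun k i => Y k i ω) (fun t k i => w t k i ω) t = k then
        F (fun i => Y k i ω) (pulls σa sel (fun k i => Y k i ω) (fun t k i => w t k i ω) t k)
        else 0) ∂P
      ≤ ∑' s, ∫⁻ ω, F (fun i => Y k i ω) s ∂P := by
  rw [← lintegral_finsetSum _ fun t _ => h.measurable_ite_arm hsel σa hF t k,
    ← lintegral_tsum fun s => (h.measurable_comp_reward k (hF s)).aemeasurable]
  refine lintegral_mono fun ω => ?_
  simp only
  rw [sum_pulls (fun s => F (fun i => Y k i ω) s)]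
  exact ENNReal.sum_le_tsum _

variable [IsProbabilityMeasure P]

lemma tsum_lintegral_atypical_le (h : IsGaussianBandit P μ Y w) (k : Fin K) {D : ℝ}
    (hD0 : 0 < D) (hD : D ≤ 1) :
    ∑' s, ∫⁻ ω, (if s = 0 then 0 else ENNReal.ofReal (atypical (μ k) D (fun i => Y k i ω) s)) ∂P
      ≤ ENNReal.ofReal (4 * (448 / D ^ 2)) := by
  rw [tsum_lintegral_ite_zero]
  calc _ ≤ ∑' s : ℕ, ENNReal.ofReal 4
        * ENNReal.ofReal (Real.exp (-(((s + 1 : ℕ) : ℝ) * (D ^ 2 / 448)))) := by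
        refine ENNReal.tsum_le_tsum fun s => ?_
        rw [← ENNReal.ofReal_mul (by norm_num), ← mul_div_assoc]
        exact lintegral_atypical_le (h.measurable_reward k) (h.law_reward k)
          (h.iIndepFun_reward k) (by omega) hD0.le hD
    _ ≤ ENNReal.ofReal 4 * ENNReal.ofReal (1 / (D ^ 2 / 448)) := by
        rw [ENNReal.tsum_mul_left]
        gcongr
        exact tsum_exp_neg_le (by positivity)
    _ = _ := by rw [← ENNReal.ofReal_mul (by norm_num), one_div_div]

lemma tsum_lintegral_oddsBound_le (h : IsGaussianBandit P μ Y w) (k : Fin K) {D : ℝ}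
    (hD0 : 0 < D) (hD : D ≤ 1) :
    ∑' s, ∫⁻ ω, (if s = 0 then 0 else oddsBound (μ k) D (fun i => Y k i ω) s) ∂P
      ≤ ENNReal.ofReal (5 * tailConst⁻¹ * (448 / D ^ 2)) := by
  have hc := tailConst_pos
  rw [tsum_lintegral_ite_zero]
  calc _ ≤ ∑' s : ℕ, ENNReal.ofReal (5 * tailConst⁻¹)
        * ENNReal.ofReal (Real.exp (-(((s + 1 : ℕ) : ℝ) * (D ^ 2 / 448)))) := by
        refine ENNReal.tsum_le_tsum fun s => ?_
        have h1 := lintegral_atypical_le (h.measurable_reward k) (h.law_reward k)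
          (h.iIndepFun_reward k) (s := s + 1) (by omega) hD0.le hD
        unfold oddsBound
        simp_rw [ENNReal.ofReal_mul (inv_pos.2 hc).le,
          fun ω => ENNReal.ofReal_add (Real.exp_pos (-(((s + 1 : ℕ) : ℝ) * D ^ 2 / 448))).le
            (atypical_nonneg (μ k) D (fun i => Y k i ω) (s + 1))]
        have hm := h.measurable_comp_reward k (measurable_atypical (μ k) D (s + 1))
        rw [lintegral_const_mul _ (by fun_prop), lintegral_add_left measurable_const,
          lintegral_const, measure_univ, mul_one, ← ENNReal.ofReal_mul (by positivity)]
        refine (mul_le_mul_right (add_le_add_right h1 _) _).trans (le_of_eq ?_)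
        rw [← ENNReal.ofReal_add (by positivity) (by positivity),
          ← ENNReal.ofReal_mul (by positivity)]
        congr 1
        rw [mul_div_assoc]
        ring
    _ ≤ ENNReal.ofReal (5 * tailConst⁻¹) * ENNReal.ofReal (1 / (D ^ 2 / 448)) := by
        rw [ENNReal.tsum_mul_left]
        gcongr
        exact tsum_exp_neg_le (by positivity)
    _ = _ := by rw [← ENNReal.ofReal_mul (by positivity), one_div_div]

/-- The case distinction behind the bound for the number of pulls of a suboptimal arm. -/
lemma measure_arm_eq_le (h : IsGaussianBandit P μ Y w) (hsel : Measurable sel)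
    (hmax : IsArgmaxRule sel) (a k : Fin K) (hD0 : 0 < μ a - μ k) {L : ℕ} (hL : 1 ≤ L) (t : ℕ) :
    P {ω | arm 1.7 sel (fun k i => Y k i ω) (fun t k i => w t k i ω) t = k}
      ≤ ∫⁻ ω, (if arm 1.7 sel (fun k i => Y k i ω) (fun t k i => w t k i ω) t = k then
          pullWeight L (μ k) (μ a - μ k) (fun i => Y k i ω)
            (pulls 1.7 sel (fun k i => Y k i ω) (fun t k i => w t k i ω) t k) else 0) ∂P
        + ENNReal.ofReal (Real.exp (-(L * (μ a - μ k) ^ 2 / 448)))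
        + ∫⁻ ω, (if arm 1.7 sel (fun k i => Y k i ω) (fun t k i => w t k i ω) t = a then
          (fun y s => if s = 0 then 0 else oddsBound (μ a) (μ a - μ k) y s) (fun i => Y a i ω)
            (pulls 1.7 sel (fun k i => Y k i ω) (fun t k i => w t k i ω) t a) else 0) ∂P := by
  set D := μ a - μ k with hD
  set A := {ω | L ≤ pulls 1.7 sel (fun k i => Y k i ω) (fun t k i => w t k i ω) t k ∧
        atypical (μ k) D (fun i => Y k i ω)
          (pulls 1.7 sel (fun k i => Y k i ω) (fun t k i => w t k i ω) t k) < 1 ∧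
        μ k + D / 2 < roundIndex 1.7 sel (fun k i => Y k i ω) (fun t k i => w t k i ω) t k} with hA
  set B := {ω | K ≤ t ∧ ∀ j, roundIndex 1.7 sel (fun k i => Y k i ω) (fun t k i => w t k i ω) t j
        ≤ μ a - D / 2} with hB
  have hPA : P A ≤ ENNReal.ofReal (Real.exp (-(L * D ^ 2 / 448))) :=
    h.measure_typical_lt_roundIndex hsel t k hD0 hL
  have hPB : P B ≤ ∫⁻ ω, (if arm 1.7 sel (fun k i => Y k i ω) (fun t k i => w t k i ω) t = a then
          (fun y s => if s = 0 then 0 else oddsBound (μ a) D y s) (fun i => Y a i ω)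
            (pulls 1.7 sel (fun k i => Y k i ω) (fun t k i => w t k i ω) t a) else 0) ∂P := by
    by_cases ht : K ≤ t
    · have e : B = {ω | ∀ j, roundIndex 1.7 sel (fun k i => Y k i ω)
          (fun t k i => w t k i ω) t j ≤ μ a - D / 2} := by
        ext ω; simp [hB, ht]
      rw [e]
      refine (h.measure_forall_roundIndex_le hsel hmax ht a hD0).trans (le_of_eq ?_)
      refine lintegral_congr fun ω => ?_
      have := pulls_pos (σa := 1.7) (sel := sel) (Y := fun k i => Y k i ω)
        (w := fun t k i => w t k i ω) ht a
      simp only [show ¬ pulls 1.7 sel (fun k i => Y k i ω) (fun t k i => w t k i ω) t a = 0 by omega,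
        if_false]
    · have e : B = ∅ := by
        ext ω; simp [hB, ht]
      rw [e, measure_empty]
      exact zero_le
  have hS : MeasurableSet {ω | arm 1.7 sel (fun k i => Y k i ω) (fun t k i => w t k i ω) t = k} :=
    h.measurable_arm_apply hsel 1.7 t (measurableSet_singleton k)
  have hmeas := h.measurable_ite_arm hsel 1.7 (measurable_pullWeight L (μ k) D) t k
  rw [← lintegral_indicator_one hS, add_assoc]
  refine le_trans ?_ (add_le_add_right ((lintegral_indicator_one_le (A ∪ B)).trans
    ((measure_union_le A B).trans (add_le_add hPA hPB))) _)
  rw [← lintegral_add_left hmeas]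
  refine lintegral_mono fun ω => ?_
  by_cases hk : arm 1.7 sel (fun k i => Y k i ω) (fun t k i => w t k i ω) t = k
  swap
  · simp [Set.indicator_apply, hk]
  rw [Set.indicator_of_mem (show ω ∈ {ω | arm 1.7 sel (fun k i => Y k i ω)
    (fun t k i => w t k i ω) t = k} from hk), if_pos hk]
  by_cases hn : pulls 1.7 sel (fun k i => Y k i ω) (fun t k i => w t k i ω) t k < L
  · simp only [pullWeight, hn, if_true, Pi.one_apply, add_assoc]
    exact le_self_add
  have hn' := not_lt.1 hn
  -- In the initial rounds the pulled arm has no earlier pull, which `1 ≤ L ≤ pulls` excludes.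
  have ht : K ≤ t := by
    by_contra ht
    rw [arm_of_lt (not_le.1 ht)] at hk
    have := pulls_of_le (σa := 1.7) (sel := sel) (Y := fun k i => Y k i ω)
        (w := fun t k i => w t k i ω) (t := t) (k := k) (by rw [← hk])
    omega
  by_cases hat : atypical (μ k) D (fun i => Y k i ω)
      (pulls 1.7 sel (fun k i => Y k i ω) (fun t k i => w t k i ω) t k) < 1
  swap
  · refine le_trans ?_ le_self_add
    refine le_trans ?_ (le_add_self)
    rw [if_neg (by omega)]
    simpa using not_lt.1 hat
  refine le_trans (le_of_eq ?_) le_add_self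
  rw [Set.indicator_of_mem]
  by_cases hi : μ k + D / 2 < roundIndex 1.7 sel (fun k i => Y k i ω) (fun t k i => w t k i ω) t k
  · exact Or.inl ⟨hn', hat, hi⟩
  -- The index of the pulled arm `k` is maximal, and `μ k + D / 2 = μ a - D / 2`.
  · refine Or.inr ⟨ht, fun j => ?_⟩
    rw [arm_of_le ht] at hk
    have h1 := hmax (fun k => roundIndex 1.7 sel (fun k i => Y k i ω) (fun t k i => w t k i ω) t k) j
    have h2 : sel (fun k => roundIndex 1.7 sel (fun k i => Y k i ω)
      (fun t k i => w t k i ω) t k) = k := hk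
    rw [h2] at h1
    linarith [not_lt.1 hi]

/-- The terms are `L` for the early pulls, `4 * 448 / D²` for atypical histories, `1` for the
exceptional indices over `T` rounds, and `5 * tailConst⁻¹ * 448 / D²` for the rounds charged to arm
`a`. -/
lemma sum_measure_arm_eq_le (h : IsGaussianBandit P μ Y w) (hsel : Measurable sel)
    (hmax : IsArgmaxRule sel) (a k : Fin K) (hD0 : 0 < μ a - μ k) (hD : μ a - μ k ≤ 1) {L : ℕ}
    (hL : 1 ≤ L) {T : ℕ} (hT : T * Real.exp (-(L * (μ a - μ k) ^ 2 / 448)) ≤ 1) :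
    ∑ t ∈ Finset.range T, P {ω | arm 1.7 sel (fun k i => Y k i ω) (fun t k i => w t k i ω) t = k}
      ≤ ENNReal.ofReal (L + 1 + (4 + 5 * tailConst⁻¹) * (448 / (μ a - μ k) ^ 2)) := by
  have hc := tailConst_pos
  refine (Finset.sum_le_sum fun t _ =>
    h.measure_arm_eq_le hsel hmax a k hD0 hL t).trans ?_
  rw [Finset.sum_add_distrib, Finset.sum_add_distrib]
  have h1 := (h.sum_lintegral_ite_arm_le hsel 1.7
    (measurable_pullWeight L (μ k) (μ a - μ k)) k T)
  have h2 := (h.sum_lintegral_ite_arm_le hsel 1.7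
    (F := fun y s => if s = 0 then 0 else oddsBound (μ a) (μ a - μ k) y s)
    (fun s => by split_ifs; exacts [measurable_const, measurable_oddsBound _ _ _]) a T).trans
    (h.tsum_lintegral_oddsBound_le a hD0 hD)
  have h3 : ∑' s, ∫⁻ ω, pullWeight L (μ k) (μ a - μ k) (fun i => Y k i ω) s ∂P
      ≤ ENNReal.ofReal L + ENNReal.ofReal (4 * (448 / (μ a - μ k) ^ 2)) := by
    unfold pullWeight
    simp_rw [lintegral_add_left measurable_const]
    rw [ENNReal.tsum_add]
    refine add_le_add (le_of_eq ?_) (h.tsum_lintegral_atypical_le k hD0 hD)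
    simp only [lintegral_const, measure_univ, mul_one]
    rw [tsum_eq_sum (s := Finset.range L) (fun s hs => by simpa using hs),
      Finset.sum_congr rfl (fun s hs => if_pos (Finset.mem_range.1 hs))]
    simp
  have h4 : ∑ _t ∈ Finset.range T, ENNReal.ofReal (Real.exp (-(L * (μ a - μ k) ^ 2 / 448)))
      ≤ ENNReal.ofReal 1 := by
    rw [Finset.sum_const, Finset.card_range, nsmul_eq_mul, ← ENNReal.ofReal_natCast,
      ← ENNReal.ofReal_mul (Nat.cast_nonneg _)]
    exact ENNReal.ofReal_le_ofReal hT
  refine (add_le_add (add_le_add (h1.trans h3) h4) h2).trans (le_of_eq ?_)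
  rw [← ENNReal.ofReal_add (by positivity) (by positivity),
    ← ENNReal.ofReal_add (by positivity) (by positivity),
    ← ENNReal.ofReal_add (by positivity) (by positivity)]
  congr 1
  ring

end IsGaussianBandit

/-! ### Expected rewards and the regret decomposition -/

section PullEvent
variable {K : ℕ} {Ω : Type*}

/-- The event that round `t` is the pull number `s` of arm `k`. -/
def pullEvent (σa : ℝ) (sel : (Fin K → ℝ) → Fin K) (Y : Fin K → ℕ → Ω → ℝ)
    (w : ℕ → Fin K → ℕ → Ω → ℝ) (t : ℕ) (k : Fin K) (s : ℕ) : Set Ω :=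
  {ω | arm σa sel (fun k i => Y k i ω) (fun t k i => w t k i ω) t = k ∧
    pulls σa sel (fun k i => Y k i ω) (fun t k i => w t k i ω) t k = s}

/-- Splitting over all arms and pull numbers replaces the randomly indexed reward by fixed variables
`Y k s`, each independent of its own pull event. -/
lemma reward_eq_sum {Y : Fin K → ℕ → Ω → ℝ}
    {w : ℕ → Fin K → ℕ → Ω → ℝ} {sel : (Fin K → ℝ) → Fin K} (σa : ℝ) (t : ℕ) (ω : Ω) :
    reward σa sel (fun k i => Y k i ω) (fun t k i => w t k i ω) t
      = ∑ k, ∑ s ∈ Finset.range (t + 1), (pullEvent σa sel Y w t k s).indicator (Y k s) ω := by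
  set k₀ := arm σa sel (fun k i => Y k i ω) (fun t k i => w t k i ω) t with hk
  set s₀ := pulls σa sel (fun k i => Y k i ω) (fun t k i => w t k i ω) t k₀ with hs
  rw [Finset.sum_eq_single k₀, Finset.sum_eq_single s₀]
  · rw [Set.indicator_of_mem (show ω ∈ pullEvent σa sel Y w t k₀ s₀ from ⟨rfl, rfl⟩)]
    rfl
  · exact fun s _ hne => Set.indicator_of_notMem (fun hc => hne hc.2.symm) _
  · intro hc
    exact absurd (Finset.mem_range.2 (Nat.lt_succ_of_le (pulls_le t k₀))) hc
  · exact fun k _ hne => Finset.sum_eq_zero fun s _ =>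
      Set.indicator_of_notMem (fun hc => hne hc.1.symm) _
  · simp

end PullEvent

namespace IsGaussianBandit
variable {K : ℕ} {Ω : Type*} [MeasurableSpace Ω] {P : Measure Ω} {μ : Fin K → ℝ}
  {Y : Fin K → ℕ → Ω → ℝ} {w : ℕ → Fin K → ℕ → Ω → ℝ} {sel : (Fin K → ℝ) → Fin K}

lemma measurableSet_arm_pulls (hsel : Measurable sel) (σa : ℝ) (t : ℕ) (k : Fin K) (s : ℕ) :
    MeasurableSet {b : (Fin K → ℕ → ℝ) × (ℕ → Fin K → ℕ → ℝ) |
      arm σa sel b.1 b.2 t = k ∧ pulls σa sel b.1 b.2 t k = s} :=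
  ((measurable_arm_pulls hsel t).1 (measurableSet_singleton k)).inter
    (measurable_pulls_apply hsel t k (measurableSet_singleton s))

lemma measurableSet_pullEvent (h : IsGaussianBandit P μ Y w) (hsel : Measurable sel) (σa : ℝ)
    (t : ℕ) (k : Fin K) (s : ℕ) : MeasurableSet (pullEvent σa sel Y w t k s) :=
  measurable_history h.measurable_reward h.measurable_weight
    (measurableSet_arm_pulls hsel σa t k s)

lemma integrable_reward_apply (h : IsGaussianBandit P μ Y w) (k : Fin K) (s : ℕ) :
    Integrable (Y k s) P := by
  have h1 : Integrable (id : ℝ → ℝ) (P.map (Y k s)) := by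
    rw [h.law_reward]
    exact (memLp_id_gaussianReal 1).integrable le_rfl
  exact h1.comp_measurable (h.measurable_reward k s)

lemma integral_reward_apply (h : IsGaussianBandit P μ Y w) (k : Fin K) (s : ℕ) :
    ∫ ω, Y k s ω ∂P = μ k := by
  have h1 := integral_map (μ := P) (h.measurable_reward k s).aemeasurable (f := fun x : ℝ => x)
    (by fun_prop)
  rw [h.law_reward] at h1
  rw [← h1]
  exact integral_id_gaussianReal

/-- Whether round `t` is the pull number `s` of arm `k` does not depend on the reward of that
pull. -/
lemma integral_indicator_pullEvent (h : IsGaussianBandit P μ Y w) (hsel : Measurable sel)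
    (σa : ℝ) (t : ℕ) (k : Fin K) (s : ℕ) :
    ∫ ω, (pullEvent σa sel Y w t k s).indicator (Y k s) ω ∂P
      = μ k * P.real (pullEvent σa sel Y w t k s) := by
  have hS := measurableSet_arm_pulls (sel := sel) hsel σa t k s
  have hφ : Measurable (Set.indicator {b : (Fin K → ℕ → ℝ) × (ℕ → Fin K → ℕ → ℝ) |
      arm σa sel b.1 b.2 t = k ∧ pulls σa sel b.1 b.2 t k = s} (fun _ => (1 : ℝ))) :=
    measurable_const.indicator hS
  have hind := (h.indepFun_reward k s).comp measurable_id hφ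
  -- The event is unchanged when `Y k s` is overwritten by `0`, so it is determined by variables
  -- independent of `Y k s`.
  have e : ∀ ω, (pullEvent σa sel Y w t k s).indicator 1 ω
      = Set.indicator {b : (Fin K → ℕ → ℝ) × (ℕ → Fin K → ℕ → ℝ) |
      arm σa sel b.1 b.2 t = k ∧ pulls σa sel b.1 b.2 t k = s} (fun _ => (1 : ℝ))
      (fun j i => if j = k ∧ i = s then 0 else Y j i ω, fun t j i => w t j i ω) := by
    intro ω
    have hiff := arm_pulls_iff (σa := σa) (sel := sel) (Y := fun k i => Y k i ω)
      (w := fun t k i => w t k i ω) (k := k) (s := s)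
      (Y' := fun j i => if j = k ∧ i = s then 0 else Y j i ω)
      (fun j i hji => by
        rw [if_neg]
        simpa using hji) t
    by_cases hω : ω ∈ pullEvent σa sel Y w t k s
    · rw [Set.indicator_of_mem hω, Set.indicator_of_mem]
      · rfl
      · exact hiff.1 hω
    · rw [Set.indicator_of_notMem hω, Set.indicator_of_notMem]
      exact fun hc => hω (hiff.2 hc)
  have h1 := hind.integral_fun_mul_eq_mul_integral
    (h.measurable_reward k s).aestronglyMeasurable
    (hφ.comp (measurable_history (Y := fun j i ω => if j = k ∧ i = s then 0 else Y j i ω)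
      (fun j i => measurable_ite_zero fun _ => h.measurable_reward j i)
      h.measurable_weight)).aestronglyMeasurable
  simp only [Function.comp_apply, id_eq, ← e] at h1
  rw [integral_indicator_one (h.measurableSet_pullEvent hsel σa t k s),
    h.integral_reward_apply] at h1
  rw [← h1]
  refine integral_congr_ae (Filter.Eventually.of_forall fun ω => ?_)
  by_cases hω : ω ∈ pullEvent σa sel Y w t k s <;> simp [hω]

lemma integrable_indicator_pullEvent (h : IsGaussianBandit P μ Y w) (hsel : Measurable sel)
    (σa : ℝ) (t : ℕ) (k : Fin K) (s : ℕ) :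
    Integrable ((pullEvent σa sel Y w t k s).indicator (Y k s)) P :=
  (h.integrable_reward_apply k s).indicator (h.measurableSet_pullEvent hsel σa t k s)

lemma integrable_reward (h : IsGaussianBandit P μ Y w) (hsel : Measurable sel) (σa : ℝ) (t : ℕ) :
    Integrable (fun ω => reward σa sel (fun k i => Y k i ω) (fun t k i => w t k i ω) t) P := by
  simp_rw [reward_eq_sum]
  exact integrable_finsetSum _ fun k _ => integrable_finsetSum _ fun s _ =>
    h.integrable_indicator_pullEvent hsel σa t k s

lemma integrable_totalReward (h : IsGaussianBandit P μ Y w) (hsel : Measurable sel) (σa : ℝ)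
    (T : ℕ) :
    Integrable (fun ω => totalReward σa sel (fun k i => Y k i ω) (fun t k i => w t k i ω) T) P :=
  integrable_finsetSum _ fun t _ => h.integrable_reward hsel σa t

variable [IsProbabilityMeasure P]

lemma sum_real_pullEvent (h : IsGaussianBandit P μ Y w) (hsel : Measurable sel) (σa : ℝ) (t : ℕ)
    (k : Fin K) :
    ∑ s ∈ Finset.range (t + 1), P.real (pullEvent σa sel Y w t k s)
      = P.real {ω | arm σa sel (fun k i => Y k i ω) (fun t k i => w t k i ω) t = k} := by
  rw [← measureReal_biUnion_finset]
  · congr 1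
    ext ω
    simp only [Set.mem_iUnion, Finset.mem_range, pullEvent, Set.mem_ofPred_eq, exists_prop]
    constructor
    · rintro ⟨s, -, h1, -⟩
      exact h1
    · intro h1
      exact ⟨_, Nat.lt_succ_of_le (pulls_le t k), h1, rfl⟩
  · intro s _ s' _ hne
    refine Set.disjoint_left.2 fun ω h1 h2 => hne (h1.2.symm.trans h2.2)
  · exact fun s _ => h.measurableSet_pullEvent hsel σa t k s

lemma integral_reward (h : IsGaussianBandit P μ Y w) (hsel : Measurable sel) (σa : ℝ) (t : ℕ) :
    ∫ ω, reward σa sel (fun k i => Y k i ω) (fun t k i => w t k i ω) t ∂P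
      = ∑ k, μ k
        * P.real {ω | arm σa sel (fun k i => Y k i ω) (fun t k i => w t k i ω) t = k} := by
  simp_rw [reward_eq_sum]
  rw [integral_finsetSum _ fun k _ => integrable_finsetSum _ fun s _ =>
    h.integrable_indicator_pullEvent hsel σa t k s]
  refine Finset.sum_congr rfl fun k _ => ?_
  rw [integral_finsetSum _ fun s _ => h.integrable_indicator_pullEvent hsel σa t k s]
  simp_rw [h.integral_indicator_pullEvent hsel]
  rw [← Finset.mul_sum, h.sum_real_pullEvent hsel]

lemma sum_real_arm_eq (h : IsGaussianBandit P μ Y w) (hsel : Measurable sel) (σa : ℝ) (t : ℕ) :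
    ∑ k, P.real {ω | arm σa sel (fun k i => Y k i ω) (fun t k i => w t k i ω) t = k} = 1 := by
  rw [← measureReal_biUnion_finset]
  · have : (⋃ k ∈ (Finset.univ : Finset (Fin K)), {ω | arm σa sel (fun k i => Y k i ω)
        (fun t k i => w t k i ω) t = k}) = Set.univ := by
      ext ω; simp
    rw [this]
    simp
  · intro k _ k' _ hne
    refine Set.disjoint_left.2 fun ω h1 h2 => hne (h1.symm.trans h2)
  · exact fun k _ => h.measurable_arm_apply hsel σa t (measurableSet_singleton k)

/-- The regret is the sum of the gaps weighted by the expected numbers of pulls. -/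
lemma regret_eq [NeZero K] (h : IsGaussianBandit P μ Y w) (hsel : Measurable sel) (σa : ℝ)
    (T : ℕ) :
    regret P μ σa sel Y w T = ∑ k, gap μ k * ∑ t ∈ Finset.range T,
      P.real {ω | arm σa sel (fun k i => Y k i ω) (fun t k i => w t k i ω) t = k} := by
  unfold regret totalReward
  rw [integral_finsetSum _ fun t _ => h.integrable_reward hsel σa t]
  simp_rw [h.integral_reward hsel, gap, sub_mul, Finset.sum_sub_distrib, Finset.mul_sum]
  rw [Finset.sum_comm (s := Finset.univ), Finset.sum_comm (s := Finset.univ)]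
  congr 1
  simp_rw [← Finset.mul_sum, h.sum_real_arm_eq hsel]
  simp [mul_comm]

/-! ### The logarithmic threshold and the absolute constant -/

lemma sum_real_arm_eq_le (h : IsGaussianBandit P μ Y w) (hsel : Measurable sel)
    (hmax : IsArgmaxRule sel) (a k : Fin K) (hD0 : 0 < μ a - μ k) (hD : μ a - μ k ≤ 1) {T : ℕ}
    (hT : 1 ≤ T) :
    ∑ t ∈ Finset.range T,
        P.real {ω | arm 1.7 sel (fun k i => Y k i ω) (fun t k i => w t k i ω) t = k}
      ≤ 448 * Real.log T / (μ a - μ k) ^ 2 + 3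
        + (4 + 5 * tailConst⁻¹) * (448 / (μ a - μ k) ^ 2) := by
  have hc := tailConst_pos
  have hT0 : (0 : ℝ) < T := by exact_mod_cast hT
  have hlog : 0 ≤ Real.log T := Real.log_nonneg (by exact_mod_cast hT)
  set D := μ a - μ k
  set x := 448 * Real.log T / D ^ 2 with hx
  have hx0 : 0 ≤ x := by positivity
  -- `L = ⌈x⌉₊ + 1` is positive even when `T = 1`, where `x = 0`.
  have hL : x ≤ (⌈x⌉₊ + 1 : ℕ) := (Nat.le_ceil x).trans (by push_cast; linarith)
  have hTe : T * Real.exp (-((⌈x⌉₊ + 1 : ℕ) * D ^ 2 / 448)) ≤ 1 := by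
    have h1 : Real.log T ≤ (⌈x⌉₊ + 1 : ℕ) * D ^ 2 / 448 := by
      rw [hx, div_le_iff₀ (by positivity)] at hL
      linarith
    calc T * Real.exp (-((⌈x⌉₊ + 1 : ℕ) * D ^ 2 / 448)) ≤ T * Real.exp (-Real.log T) := by gcongr
      _ = 1 := by rw [Real.exp_neg, Real.exp_log hT0, mul_inv_cancel₀ hT0.ne']
  have key := h.sum_measure_arm_eq_le hsel hmax a k hD0 hD (L := ⌈x⌉₊ + 1) (by omega) hTe
  have e : ∑ t ∈ Finset.range T,
        P.real {ω | arm 1.7 sel (fun k i => Y k i ω) (fun t k i => w t k i ω) t = k}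
      = (∑ t ∈ Finset.range T,
        P {ω | arm 1.7 sel (fun k i => Y k i ω) (fun t k i => w t k i ω) t = k}).toReal := by
    rw [ENNReal.toReal_sum fun t _ => measure_ne_top _ _]
    rfl
  rw [e]
  refine (ENNReal.toReal_le_of_le_ofReal (by positivity) key).trans ?_
  have := (Nat.ceil_lt_add_one hx0).le
  push_cast
  linarith

end IsGaussianBandit

end ReBoot

end

theorem corollary1 :
    ∃ C : ℝ, 0 < C ∧
      ∀ (K : ℕ) [NeZero K] (μ : Fin K → ℝ),
        (∀ k, μ k ≤ μ 0) → (∀ k, ReBoot.gap μ k < 1) →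
      ∀ (sel : (Fin K → ℝ) → Fin K), Measurable sel → ReBoot.IsArgmaxRule sel →
      ∀ (Ω : Type*) [MeasurableSpace Ω] (P : Measure Ω) [IsProbabilityMeasure P]
        (Y : Fin K → ℕ → Ω → ℝ) (w : ℕ → Fin K → ℕ → Ω → ℝ),
        ReBoot.IsGaussianBandit P μ Y w →
      ∀ T : ℕ, 1 ≤ T →
        Integrable (fun ω => ReBoot.totalReward (1.7 : ℝ) sel (fun k i => Y k i ω)
          (fun t k i => w t k i ω) T) P ∧
        ReBoot.regret P μ (1.7 : ℝ) sel Y w T ≤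
          C * ((∑ k : Fin K with 0 < ReBoot.gap μ k, ReBoot.gap μ k) +
            (∑ k : Fin K with 0 < ReBoot.gap μ k, Real.log T / ReBoot.gap μ k)) := by
  have hc := ReBoot.tailConst_pos
  set c : ℝ := (4 + 5 * ReBoot.tailConst⁻¹) * 448 with hcdef
  have hc0 : 0 < c := by positivity
  -- The factor `2` turns the term `c / D` into a multiple of `log T / D`, as `log T ≥ 1 / 2` for `T
  -- ≥ 2`.
  refine ⟨448 + 2 * c, by positivity, ?_⟩
  intro K _ μ hopt hgap sel hsel hmax Ω _ P _ Y w h T hT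
  refine ⟨h.integrable_totalReward hsel _ T, ?_⟩
  rw [h.regret_eq hsel, ← Finset.sum_add_distrib, Finset.mul_sum,
    ← Finset.sum_filter_add_sum_filter_not Finset.univ (fun k => 0 < ReBoot.gap μ k)]
  rw [Finset.sum_eq_zero (s := Finset.univ.filter fun k => ¬ 0 < ReBoot.gap μ k), add_zero]
  swap
  · intro k hk
    have h0 : 0 ≤ ReBoot.gap μ k := sub_nonneg.2 (hopt k)
    have : ReBoot.gap μ k = 0 := le_antisymm (not_lt.1 (Finset.mem_filter.1 hk).2) h0
    rw [this, zero_mul]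
  refine Finset.sum_le_sum fun k hk => ?_
  have hD := (Finset.mem_filter.1 hk).2
  set D := ReBoot.gap μ k with hDdef
  set N := ∑ t ∈ Finset.range T,
    P.real {ω | ReBoot.arm 1.7 sel (fun k i => Y k i ω) (fun t k i => w t k i ω) t = k}
  rcases hT.eq_or_lt with rfl | hT2
  -- For `T = 1` the logarithm vanishes, but an arm is pulled at most once and the sum of the gaps
  -- suffices.
  · have hN : N ≤ 1 := by
      simp only [N, Finset.range_one, Finset.sum_singleton]
      exact measureReal_le_one
    simp only [Nat.cast_one, Real.log_one, zero_div, add_zero]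
    nlinarith
  · have hN : N ≤ 448 * Real.log T / D ^ 2 + 3
        + (4 + 5 * ReBoot.tailConst⁻¹) * (448 / D ^ 2) :=
      h.sum_real_arm_eq_le hsel hmax 0 k hD (hgap k).le hT
    have hlog : 1 / 2 ≤ Real.log T := by
      have h1 : Real.log 2 ≤ Real.log T := Real.log_le_log (by norm_num) (by exact_mod_cast hT2)
      linarith [Real.log_two_gt_d9]
    have h2 : 1 / D ≤ 2 * (Real.log T / D) := by
      rw [← mul_div_assoc]
      gcongr
      linarith
    calc D * N ≤ D * (448 * Real.log T / D ^ 2 + 3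
        + (4 + 5 * ReBoot.tailConst⁻¹) * (448 / D ^ 2)) := by gcongr
      _ = 448 * (Real.log T / D) + 3 * D + c * (1 / D) := by
          rw [hcdef]
          field_simp
      _ ≤ 448 * (Real.log T / D) + 3 * D + c * (2 * (Real.log T / D)) := by gcongr
      _ ≤ _ := by
          have : 0 ≤ Real.log T / D := by positivity
          nlinarith [mul_pos hc0 hD]
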